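/- A signed digraph $\Phi=(G,\varphi)$ consists of a (finite, simple, undirected) graph $G$ and a map $\varphi$ that assigns to every ordered pair $(u,v)$ of adjacent vertices a sixth root of unity $\varphi(u,v)\in\{\omega^k : k\in\mathbb{Z}\}$, $\omega=(1+i\sqrt3)/2$, with $\varphi(v,u)=\varphi(u,v)^{-1}$. Its Hermitian matrix $\mathcal{E}(\Phi)$ has the entry $\varphi(u,v)$ at adjacent $u,v$ and $0$ elsewhere, and $\lambda_1\ge\lambda_2\ge\cdots\ge\lambda_n$ are the eigenvalues of $\mathcal{E}(\Phi)$. Two signed digraphs are switching isomorphic, written $\Phi_1\sim\Phi_2$, if one is obtained from the other by a finite sequence of gain switchings $\mathcal{E}\mapsto X\mathcal{E}X^{-1}$ ($X$ diagonal with sixth roots of unity on the diagonal) and permutations of the vertices, possibly followed by taking the converse (replacing $\varphi(u,v)$ by $\varphi(v,u)$ for all $u,v$). A graph is regarded as the signed digraph whose gains are all $1$. Let $p,q\ge 2$ be integers, and let $G=CE(P_4,[p\ 1\ 1\ q])$ be the graph obtained from the path $P_4$ with vertices $1,2,3,4$ and edges $12,23,34$ by replacing vertex $1$ by a clique $P$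 on $p$ vertices and vertex $4$ by a clique $Q$ on $q$ vertices, with every vertex of $P$ adjacent to vertex $2$ and every vertex of $Q$ adjacent to vertex $3$. Let $u\ne v$ be vertices in $P$ and let $s\neq t$ be vertices in $Q$. Let $\tilde\Phi$ be the signed digraph on $G$ with $\tilde\varphi(u,v)=\omega$, $\tilde\varphi(v,u)=\omega^{-1}$ and all other gains $1$, and let $\hat\Phi$ be the signed digraph on $G$ with $\hat\varphi(s,t)=\omega$, $\hat\varphi(t,s)=\omega^{-1}$ and all other gains $1$. Then a signed digraph $\Phi=(G,\varphi)$ on $G$ satisfies $\lambda_2>0>\lambda_3$ if and only if $\Phi\sim G$, $\Phi\sim\tilde\Phi$ or $\Phi\sim\hat\Phi$. -/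

import Mathlib

/-- The primitive sixth root of unity `ω = (1 + i√3) / 2`. -/
noncomputable def sixthRoot : ℂ := (1 + Complex.I * (Real.sqrt 3 : ℂ)) / 2

/-- The multiplicative group of the sixth roots of unity, as a set of complex numbers. -/
def gainSet : Set ℂ := {z | ∃ k : ℕ, z = sixthRoot ^ k}

theorem sixthRoot_cube : sixthRoot ^ 3 = -1 := by
  have h3 : ((Real.sqrt 3 : ℝ) : ℂ) ^ 2 = 3 := by
    have h : (Real.sqrt 3) ^ 2 = 3 := Real.sq_sqrt (by norm_num)
    exact_mod_cast h
  have hI : Complex.I ^ 2 = -1 := Complex.I_sq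
  have hm : sixthRoot ^ 2 = sixthRoot - 1 := by
    unfold sixthRoot
    linear_combination (1 / 4 : ℂ) * Complex.I ^ 2 * h3 + (3 / 4 : ℂ) * hI
  linear_combination (sixthRoot + 1) * hm

theorem sixthRoot_pow_six : sixthRoot ^ 6 = 1 := by
  linear_combination (sixthRoot ^ 3 - 1) * sixthRoot_cube

theorem one_mem_gainSet : (1 : ℂ) ∈ gainSet := ⟨0, by simp⟩

theorem sixthRoot_mem_gainSet : sixthRoot ∈ gainSet := ⟨1, by simp⟩

theorem sixthRoot_inv_mem_gainSet : sixthRoot⁻¹ ∈ gainSet :=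
  ⟨5, inv_eq_of_mul_eq_one_right (by rw [← sixthRoot_pow_six]; ring)⟩

theorem star_eq_inv_of_mem_gainSet {z : ℂ} (hz : z ∈ gainSet) : star z = z⁻¹ := by
  obtain ⟨k, rfl⟩ := hz
  have h1 : ‖sixthRoot ^ k‖ = 1 := by
    rw [norm_pow, Complex.norm_eq_one_of_pow_eq_one sixthRoot_pow_six (by norm_num), one_pow]
  rw [Complex.inv_def, Complex.normSq_eq_norm_sq, h1]
  simp

/-- A signed directed graph on the vertex set `V`, that is, a gain graph with gains in the group
of sixth roots of unity: an underlying graph together with a gain for each of its darts (ordered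
pairs of adjacent vertices), such that reversing a dart inverts its gain.
A gain `1` or `-1` is a positive or negative digon, and a gain `ω` or `-ω` on the dart `(u, v)` is
a positive or negative arc from `u` to `v`. -/
structure SignedDigraph (V : Type*) where
  graph : SimpleGraph V
  gain : graph.Dart → ℂ
  gain_mem : ∀ d, gain d ∈ gainSet
  gain_symm : ∀ d : graph.Dart, gain d.symm = (gain d)⁻¹

namespace SignedDigraph

open Classical in
/-- The Hermitian (unit Eisenstein) adjacency matrix of a signed digraph. -/
noncomputable def eisensteinMatrix {V : Type*} (Φ : SignedDigraph V) : Matrix V V ℂ :=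
  Matrix.of fun u v => if h : Φ.graph.Adj u v then Φ.gain ⟨(u, v), h⟩ else 0

theorem isHermitian_eisensteinMatrix {V : Type*} (Φ : SignedDigraph V) :
    Φ.eisensteinMatrix.IsHermitian := by
  ext u v
  rw [Matrix.conjTranspose_apply]
  unfold eisensteinMatrix
  simp only [Matrix.of_apply]
  by_cases h : Φ.graph.Adj u v
  · have h' : Φ.graph.Adj v u := h.symm
    rw [dif_pos h, dif_pos h', star_eq_inv_of_mem_gainSet (Φ.gain_mem _)]
    exact (Φ.gain_symm ⟨(v, u), h'⟩).symm
  · have h' : ¬ Φ.graph.Adj v u := fun h' => h h'.symm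
    rw [dif_neg h, dif_neg h', star_zero]

/-- The eigenvalues of a signed digraph, with multiplicity and in non-increasing order. The index
starts at `0`, so that `Φ.eigenvalue i` is the eigenvalue usually denoted `λ_{i+1}`. -/
noncomputable def eigenvalue {V : Type*} [Fintype V] [DecidableEq V] (Φ : SignedDigraph V)
    (i : Fin (Fintype.card V)) : ℝ :=
  Φ.isHermitian_eisensteinMatrix.eigenvalues₀ i

/-- The converse of a signed digraph: all its arcs are reversed, and the signs are kept. -/
def converse {V : Type*} (Φ : SignedDigraph V) : SignedDigraph V where
  graph := Φ.graph
  gain d := Φ.gain d.symm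
  gain_mem d := Φ.gain_mem d.symm
  gain_symm d := Φ.gain_symm d.symm

/-- `Φ'` is obtained from `Φ` by a gain switching: `E' = X E X⁻¹` for a diagonal matrix `X` whose
diagonal entries are sixth roots of unity. -/
def IsGainSwitching {V : Type*} [Fintype V] [DecidableEq V] (Φ Φ' : SignedDigraph V) : Prop :=
  ∃ x : V → ℂ, (∀ v, x v ∈ gainSet) ∧
    Φ'.eisensteinMatrix = Matrix.diagonal x * Φ.eisensteinMatrix * (Matrix.diagonal x)⁻¹

/-- `Φ'` is obtained from `Φ` by a permutation of the vertices. -/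
def IsRelabeling {V : Type*} (Φ Φ' : SignedDigraph V) : Prop :=
  ∃ σ : Equiv.Perm V, Φ'.eisensteinMatrix = Φ.eisensteinMatrix.submatrix σ σ

/-- Switching isomorphism: `Φ'` is obtained from `Φ` by a finite sequence of gain switchings and
vertex permutations, possibly followed by taking the converse. -/
def SwitchingIsomorphic {V : Type*} [Fintype V] [DecidableEq V] (Φ Φ' : SignedDigraph V) : Prop :=
  ∃ Ψ : SignedDigraph V,
    Relation.ReflTransGen (fun A B => IsGainSwitching A B ∨ IsRelabeling A B) Φ Ψ ∧
      (Φ' = Ψ ∨ Φ' = Ψ.converse)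

/-- A graph as a signed digraph: all gains are `1`. -/
def ofGraph {V : Type*} (G : SimpleGraph V) : SignedDigraph V where
  graph := G
  gain _ := 1
  gain_mem _ := one_mem_gainSet
  gain_symm _ := by simp

open Classical in
/-- The signed digraph on `G` whose gains are all `1`, except that the edge between `u` and `v` is
oriented as a positive arc from `u` to `v`, that is, has gain `ω` from `u` to `v`. -/
noncomputable def oneArc {V : Type*} (G : SimpleGraph V) (u v : V) : SignedDigraph V where
  graph := G
  gain d :=
    if d.fst = u ∧ d.snd = v then sixthRoot
    else if d.fst = v ∧ d.snd = u then sixthRoot⁻¹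
    else 1
  gain_mem d := by
    split_ifs
    · exact sixthRoot_mem_gainSet
    · exact sixthRoot_inv_mem_gainSet
    · exact one_mem_gainSet
  gain_symm d := by
    have hne : d.fst ≠ d.snd := d.adj.ne
    have hf : d.symm.fst = d.snd := rfl
    have hs : d.symm.snd = d.fst := rfl
    rw [hf, hs]
    by_cases h1 : d.fst = u ∧ d.snd = v
    · have h2 : ¬ (d.snd = u ∧ d.fst = v) := fun h => hne (h1.1.trans h.1.symm)
      rw [if_neg h2, if_pos h1, if_pos ⟨h1.2, h1.1⟩]
    · by_cases h2 : d.fst = v ∧ d.snd = u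
      · rw [if_neg h1, if_pos h2, if_pos ⟨h2.2, h2.1⟩, inv_inv]
      · have h1' : ¬ (d.snd = v ∧ d.fst = u) := fun h => h1 ⟨h.2, h.1⟩
        have h2' : ¬ (d.snd = u ∧ d.fst = v) := fun h => h2 ⟨h.2, h.1⟩
        rw [if_neg h1, if_neg h2, if_neg h1', if_neg h2', inv_one]

end SignedDigraph

/-- The clique expansion of a graph: every vertex `j` is replaced by a clique on `τ j` vertices, and
two vertices from different cliques are adjacent if and only if the vertices of `G` that the cliques
replace are adjacent. -/
def cliqueExpansion {W : Type*} (G : SimpleGraph W) (τ : W → ℕ) :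
    SimpleGraph (Σ j, Fin (τ j)) where
  Adj a b := G.Adj a.1 b.1 ∨ (a.1 = b.1 ∧ a ≠ b)
  symm := ⟨fun _ _ h => h.imp (fun h => h.symm) (fun h => ⟨h.1.symm, h.2.symm⟩)⟩
  loopless := ⟨fun _ h => h.elim (fun h => h.ne rfl) (fun h => h.2 rfl)⟩

/-- The vertex set of the clique expansion of the path on four vertices (numbered `0, 1, 2, 3`)
in which the first vertex is expanded to `p` vertices and the last one to `q` vertices. -/
abbrev BridgeVertex (p q : ℕ) : Type := Σ j : Fin 4, Fin ((![p, 1, 1, q] : Fin 4 → ℕ) j)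

/-- The clique expansion of the path on four vertices with expansion vector `[p, 1, 1, q]`. -/
def bridgeGraph (p q : ℕ) : SimpleGraph (BridgeVertex p q) :=
  cliqueExpansion (SimpleGraph.pathGraph 4) ![p, 1, 1, q]

theorem two_lt_card_bridgeVertex {p q : ℕ} (hp : 2 ≤ p) :
    2 < Fintype.card (BridgeVertex p q) := by
  simp only [BridgeVertex, Fintype.card_sigma, Fintype.card_fin, Fin.sum_univ_four,
    Matrix.cons_val]
  omega

/-! Write `a` and `b` for the two middle vertices. An edge in `P` and an edge in `Q` give two
orthogonal vectors on which the Hermitian form is positive, whatever the gains, so `λ₂ > 0` always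
holds and only the sign of `λ₃` matters.

If `λ₃ < 0`, no nonzero vector with nonnegative form can be orthogonal, for the form, to two
orthogonal positive vectors (`sesqForm_neg_of_eigenvalues₀_neg`). Switching along the spanning tree
of edges `Pa`, `ab`, `bQ` makes all tree gains `1` (`exists_normalized_switching`). Taking one edge
in each clique as the positive vectors, small principal submatrices then restrict the remaining
gains. Every gain in a clique has positive real part, hence is `1`, `ω` or `ω⁻¹`, and nontrivial
gains cannot occur in both cliques (`gain_re_bound`). Two nontrivial gains in one clique can neither
share a vertex (`triangle_gains`) nor be disjoint (`not_two_disjoint_arcs`). So at most one arc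
remains, and a permutation inside its clique moves it to the prescribed place and direction.

Conversely, spectra are switching isomorphism invariants, and each of the three matrices is a sum of
two positive rank one terms minus a positive semidefinite part. On the common kernel of the two
positive terms the form is negative definite (`eigenvalues₀_neg_of_decomposition`), and this kernel
has codimension at most two, so `λ₃ < 0`. -/

open Matrix
open scoped ComplexConjugate

/-- The sesquilinear form of a square complex matrix. -/
noncomputable def sesqForm {n : Type*} [Fintype n] (A : Matrix n n ℂ) (x y : n → ℂ) : ℂ :=
  star x ⬝ᵥ A *ᵥ y

/-! ### Hermitian forms and the signs of the second and third eigenvalues -/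

section SesqForm

theorem re_mul_star_mul (z w : ℂ) : (z * (star z * w)).re = ‖z‖ ^ 2 * w.re := by
  rw [← Complex.normSq_eq_norm_sq, ← mul_assoc, Complex.star_def, Complex.mul_conj,
    Complex.re_ofReal_mul]

variable {n : Type*} [Fintype n] (A : Matrix n n ℂ)

theorem sesqForm_add_left (x y z : n → ℂ) :
    sesqForm A (x + y) z = sesqForm A x z + sesqForm A y z := by
  simp [sesqForm, add_dotProduct]

theorem sesqForm_add_right (x y z : n → ℂ) :
    sesqForm A x (y + z) = sesqForm A x y + sesqForm A x z := by
  simp [sesqForm, mulVec_add, dotProduct_add]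

theorem sesqForm_smul_left (c : ℂ) (x y : n → ℂ) :
    sesqForm A (c • x) y = star c * sesqForm A x y := by
  simp [sesqForm, smul_dotProduct]

theorem sesqForm_smul_right (c : ℂ) (x y : n → ℂ) :
    sesqForm A x (c • y) = c * sesqForm A x y := by
  simp [sesqForm, mulVec_smul, dotProduct_smul]

variable {A}

theorem star_sesqForm (hA : A.IsHermitian) (x y : n → ℂ) :
    star (sesqForm A x y) = sesqForm A y x := by
  rw [sesqForm, sesqForm, ← star_dotProduct, star_mulVec, hA.eq, ← dotProduct_mulVec]

theorem sesqForm_swap_eq_zero (hA : A.IsHermitian) {x y : n → ℂ} (h : sesqForm A x y = 0) :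
    sesqForm A y x = 0 := by
  rw [← star_sesqForm hA, h, star_zero]

theorem exists_spectral_coordinates [DecidableEq n] (hA : A.IsHermitian) :
    ∃ T : (n → ℂ) ≃ₗ[ℂ] (Fin (Fintype.card n) → ℂ), ∀ x,
      (sesqForm A x x).re = ∑ k, hA.eigenvalues₀ k * ‖T x k‖ ^ 2 := by
  let U : Matrix n n ℂ := hA.eigenvectorUnitary
  have h1 : U * star U = 1 := Unitary.coe_mul_star_self hA.eigenvectorUnitary
  have h2 : star U * U = 1 := Unitary.coe_star_mul_self hA.eigenvectorUnitary
  have hs : A = U * diagonal (RCLike.ofReal ∘ hA.eigenvalues) * star U := by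
    have h := hA.spectral_theorem
    rw [Unitary.conjStarAlgAut_apply] at h
    exact h
  -- The same bijection by which `eigenvalues` is read off from `eigenvalues₀`, so coordinate `k`
  -- belongs to the `k`-th largest eigenvalue.
  let e : Fin (Fintype.card n) ≃ n := Fintype.equivOfCardEq (Fintype.card_fin _)
  let T₁ : (n → ℂ) ≃ₗ[ℂ] (n → ℂ) :=
    LinearEquiv.ofLinearMap (star U).mulVecLin U.mulVecLin
      (by rw [← mulVecLin_mul, h2, mulVecLin_one]) (by rw [← mulVecLin_mul, h1, mulVecLin_one])
  have hT : ∀ x, T₁ x = star U *ᵥ x := fun x => rfl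
  refine ⟨T₁.trans (LinearEquiv.funCongrLeft ℂ ℂ e), fun x => ?_⟩
  have hx : sesqForm A x x
      = star (T₁ x) ⬝ᵥ diagonal (RCLike.ofReal ∘ hA.eigenvalues) *ᵥ (T₁ x) := by
    rw [hT, sesqForm]
    conv_lhs => rw [hs]
    rw [star_mulVec, ← mulVec_mulVec, ← mulVec_mulVec, dotProduct_mulVec, star_eq_conjTranspose,
      conjTranspose_conjTranspose]
  rw [hx, dotProduct, Complex.re_sum, ← e.sum_comp]
  refine Finset.sum_congr rfl fun k _ => ?_
  have hk : hA.eigenvalues (e k) = hA.eigenvalues₀ k := by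
    simp [IsHermitian.eigenvalues, e]
  have hk' : (T₁.trans (LinearEquiv.funCongrLeft ℂ ℂ e)) x k = T₁ x (e k) := rfl
  rw [hk', mulVec_diagonal, Function.comp_apply, hk, Pi.star_apply, ← Complex.normSq_eq_norm_sq]
  have : star (T₁ x (e k)) * ((hA.eigenvalues₀ k : ℂ) * T₁ x (e k))
      = ((hA.eigenvalues₀ k * Complex.normSq (T₁ x (e k)) : ℝ) : ℂ) := by
    rw [Complex.ofReal_mul, Complex.normSq_eq_conj_mul_self, Complex.star_def]; ring
  exact (congrArg Complex.re this).trans (Complex.ofReal_re _)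

theorem exists_ne_zero_map_eq_zero {a b : ℕ} (hab : b < a)
    (f : (Fin a → ℂ) →ₗ[ℂ] (Fin b → ℂ)) : ∃ c, c ≠ 0 ∧ f c = 0 := by
  have h := f.ker_ne_bot_of_finrank_lt (by simpa using hab)
  obtain ⟨c, hc, h0⟩ := (Submodule.ne_bot_iff _).mp h
  exact ⟨c, h0, hc⟩

/-- A span of dimension `r + 1` meets the span of the eigenvectors with index at least `r`. -/
theorem exists_combination_neg [DecidableEq n] (hA : A.IsHermitian) {r : ℕ}
    (hr : r < Fintype.card n) (f : Fin (r + 1) → n → ℂ) :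
    ∃ c : Fin (r + 1) → ℂ, c ≠ 0 ∧
      ∃ y : Fin (Fintype.card n) → ℝ, (∀ k, 0 ≤ y k) ∧
        (y = 0 → ∑ i, c i • f i = 0) ∧ (∀ k, k.1 < r → y k = 0) ∧
        (sesqForm A (∑ i, c i • f i) (∑ i, c i • f i)).re = ∑ k, hA.eigenvalues₀ k * y k := by
  obtain ⟨T, hT⟩ := exists_spectral_coordinates hA
  let F : (Fin (r + 1) → ℂ) →ₗ[ℂ] (n → ℂ) := Fintype.linearCombination ℂ f
  let R : (Fin (Fintype.card n) → ℂ) →ₗ[ℂ] (Fin r → ℂ) :=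
    LinearMap.funLeft ℂ ℂ (fun k => ⟨k.1, k.2.trans hr⟩)
  -- `R` reads the first `r` spectral coordinates; it cannot be injective on the `r + 1`
  -- coefficients.
  obtain ⟨c, hc, h0⟩ := exists_ne_zero_map_eq_zero (Nat.lt_succ_self r)
    (R ∘ₗ T.toLinearMap ∘ₗ F)
  have hF : F c = ∑ i, c i • f i := rfl
  refine ⟨c, hc, fun k => ‖T (F c) k‖ ^ 2, fun k => by positivity, fun hy => ?_, fun k hk => ?_, ?_⟩
  · have : T (F c) = 0 := by
      ext k
      simpa using congrFun hy k
    rw [← hF]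
    simpa using this
  · have : T (F c) k = 0 := congrFun h0 ⟨k.1, hk⟩
    simp [this]
  · rw [← hF, hT]

/-- Some nontrivial combination of `f`, `g`, `h` has no component along the top two eigenvectors, so
its form is at most `0`. By orthogonality its form is also a sum of nonnegative terms if `h` has
nonnegative form. Equality throughout kills the coefficients of `f` and `g` and then the whole
vector, which contradicts `h ≠ 0`. -/
theorem sesqForm_neg_of_eigenvalues₀_neg [DecidableEq n] (hA : A.IsHermitian)
    (h2 : 2 < Fintype.card n) (hneg : hA.eigenvalues₀ ⟨2, h2⟩ < 0) {f g h : n → ℂ}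
    (hfg : sesqForm A f g = 0) (hfh : sesqForm A f h = 0) (hgh : sesqForm A g h = 0)
    (hf : 0 < (sesqForm A f f).re) (hg : 0 < (sesqForm A g g).re) (h0 : h ≠ 0) :
    (sesqForm A h h).re < 0 := by
  by_contra! hh
  obtain ⟨c, hc, y, hy, hy0, hyr, hs⟩ := exists_combination_neg hA h2 ![f, g, h]
  have hgf := sesqForm_swap_eq_zero hA hfg
  have hhf := sesqForm_swap_eq_zero hA hfh
  have hhg := sesqForm_swap_eq_zero hA hgh
  have hle : ∀ k, hA.eigenvalues₀ k * y k ≤ 0 := by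
    intro k
    rcases lt_or_ge k.1 2 with hk | hk
    · simp [hyr k hk]
    · have : hA.eigenvalues₀ k ≤ hA.eigenvalues₀ ⟨2, h2⟩ := hA.eigenvalues₀_antitone hk
      exact mul_nonpos_of_nonpos_of_nonneg (by linarith) (hy k)
  have hval : (sesqForm A (∑ i, c i • ![f, g, h] i) (∑ i, c i • ![f, g, h] i)).re
      = ‖c 0‖ ^ 2 * (sesqForm A f f).re + ‖c 1‖ ^ 2 * (sesqForm A g g).re
        + ‖c 2‖ ^ 2 * (sesqForm A h h).re := by
    rw [Fin.sum_univ_three]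
    simp only [cons_val, sesqForm_add_left, sesqForm_add_right,
      sesqForm_smul_left, sesqForm_smul_right, hfg, hfh, hgf, hgh, hhf, hhg, mul_zero, add_zero,
      zero_add, Complex.add_re, re_mul_star_mul]
  have hsum : ∑ k, hA.eigenvalues₀ k * y k ≤ 0 := Finset.sum_nonpos fun k _ => hle k
  have p0 := mul_nonneg (sq_nonneg ‖c 0‖) hf.le
  have p1 := mul_nonneg (sq_nonneg ‖c 1‖) hg.le
  have p2 := mul_nonneg (sq_nonneg ‖c 2‖) hh
  rw [hs] at hval
  have c0 : c 0 = 0 := by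
    have : ‖c 0‖ ^ 2 * (sesqForm A f f).re = 0 := by linarith
    simpa [hf.ne'] using this
  have c1 : c 1 = 0 := by
    have : ‖c 1‖ ^ 2 * (sesqForm A g g).re = 0 := by linarith
    simpa [hg.ne'] using this
  have hz : ∑ k, hA.eigenvalues₀ k * y k = 0 := by linarith
  have hy1 : y = 0 := by
    ext k
    have hk := (Finset.sum_eq_zero_iff_of_nonpos (fun k _ => hle k)).mp hz k (Finset.mem_univ _)
    rcases lt_or_ge k.1 2 with hk2 | hk2
    · exact hyr k hk2
    · have : hA.eigenvalues₀ k ≤ hA.eigenvalues₀ ⟨2, h2⟩ := hA.eigenvalues₀_antitone hk2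
      exact (mul_eq_zero.mp hk).resolve_left (by linarith)
  have hv := hy0 hy1
  rw [Fin.sum_univ_three] at hv
  simp only [cons_val, c0, c1, zero_smul, zero_add] at hv
  have c2 : c 2 = 0 := (smul_eq_zero.mp hv).resolve_right h0
  exact hc (by ext i; fin_cases i <;> simp [c0, c1, c2])

theorem eigenvalues₀_pos_of_sesqForm_pos [DecidableEq n] (hA : A.IsHermitian)
    (h1 : 1 < Fintype.card n) {f g : n → ℂ} (hfg : sesqForm A f g = 0)
    (hf : 0 < (sesqForm A f f).re) (hg : 0 < (sesqForm A g g).re) :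
    0 < hA.eigenvalues₀ ⟨1, h1⟩ := by
  by_contra! hneg
  obtain ⟨c, hc, y, hy, hy0, hyr, hs⟩ := exists_combination_neg hA h1 ![f, g]
  have hgf := sesqForm_swap_eq_zero hA hfg
  have hle : ∀ k, hA.eigenvalues₀ k * y k ≤ 0 := by
    intro k
    rcases lt_or_ge k.1 1 with hk | hk
    · simp [hyr k hk]
    · have : hA.eigenvalues₀ k ≤ hA.eigenvalues₀ ⟨1, h1⟩ := hA.eigenvalues₀_antitone hk
      exact mul_nonpos_of_nonpos_of_nonneg (by linarith) (hy k)
  have hval : (sesqForm A (∑ i, c i • ![f, g] i) (∑ i, c i • ![f, g] i)).re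
      = ‖c 0‖ ^ 2 * (sesqForm A f f).re + ‖c 1‖ ^ 2 * (sesqForm A g g).re := by
    rw [Fin.sum_univ_two]
    simp only [cons_val, sesqForm_add_left, sesqForm_add_right,
      sesqForm_smul_left, sesqForm_smul_right, hfg, hgf, mul_zero, add_zero,
      zero_add, Complex.add_re, re_mul_star_mul]
  have hsum : ∑ k, hA.eigenvalues₀ k * y k ≤ 0 := Finset.sum_nonpos fun k _ => hle k
  have p0 := mul_nonneg (sq_nonneg ‖c 0‖) hf.le
  have p1 := mul_nonneg (sq_nonneg ‖c 1‖) hg.le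
  rw [hs] at hval
  have c0 : c 0 = 0 := by
    have : ‖c 0‖ ^ 2 * (sesqForm A f f).re = 0 := by linarith
    simpa [hf.ne'] using this
  have c1 : c 1 = 0 := by
    have : ‖c 1‖ ^ 2 * (sesqForm A g g).re = 0 := by linarith
    simpa [hg.ne'] using this
  exact hc (by ext i; fin_cases i <;> simp [c0, c1])

/-- Two linear conditions leave a nonzero vector in the span of the top three eigenvectors, where
the form would be nonnegative if `λ₃ ≥ 0`. -/
theorem eigenvalues₀_neg_of_sesqForm_neg [DecidableEq n] (hA : A.IsHermitian)
    (h2 : 2 < Fintype.card n) (l m : n → ℂ)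
    (hneg : ∀ x, x ≠ 0 → l ⬝ᵥ x = 0 → m ⬝ᵥ x = 0 → (sesqForm A x x).re < 0) :
    hA.eigenvalues₀ ⟨2, h2⟩ < 0 := by
  by_contra! hpos
  obtain ⟨T, hT⟩ := exists_spectral_coordinates hA
  let ι : Fin 3 → Fin (Fintype.card n) := fun k => ⟨k.1, by omega⟩
  let J : (Fin 3 → ℂ) →ₗ[ℂ] (Fin (Fintype.card n) → ℂ) :=
    Fintype.linearCombination ℂ fun k => Pi.single (ι k) 1
  let R : (n → ℂ) →ₗ[ℂ] (Fin 2 → ℂ) := (Matrix.of ![l, m]).mulVecLin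
  obtain ⟨c, hc, h0⟩ := exists_ne_zero_map_eq_zero (by norm_num : 2 < 3)
    (R ∘ₗ T.symm.toLinearMap ∘ₗ J)
  have hJ : ∀ k, J c k = if h : k.1 < 3 then c ⟨k.1, h⟩ else 0 := by
    intro k
    simp only [J, Fintype.linearCombination_apply, Finset.sum_apply, Pi.smul_apply, smul_eq_mul,
      Pi.single_apply, mul_ite, mul_one, mul_zero, Fin.sum_univ_three, ι, Fin.ext_iff]
    obtain ⟨k, hk⟩ := k
    rcases k with _ | _ | _ | k <;> simp
  have hJ0 : J c ≠ 0 := by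
    intro h
    apply hc
    ext k
    have := congrFun h (ι k)
    rw [hJ] at this
    simpa [ι] using this
  have hx : T.symm (J c) ≠ 0 := by simpa using hJ0
  have hlt := hneg _ hx (congrFun h0 0) (congrFun h0 1)
  rw [hT] at hlt
  refine absurd hlt (not_lt.mpr (Finset.sum_nonneg fun k _ => ?_))
  rw [LinearEquiv.apply_symm_apply]
  rcases lt_or_ge k.1 3 with hk | hk
  · have : hA.eigenvalues₀ ⟨2, h2⟩ ≤ hA.eigenvalues₀ k :=
      hA.eigenvalues₀_antitone (by rw [Fin.le_def]; exact Nat.le_of_lt_succ hk)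
    exact mul_nonneg (hpos.trans this) (by positivity)
  · rw [hJ, dif_neg (by omega)]
    simp

end SesqForm

/-! ### Negativity from rank one decompositions -/

section Decomposition

variable {n : Type*} [Fintype n]

theorem sesqForm_add_matrix (A B : Matrix n n ℂ) (x y : n → ℂ) :
    sesqForm (A + B) x y = sesqForm A x y + sesqForm B x y := by
  simp [sesqForm, add_mulVec, dotProduct_add]

theorem sesqForm_sub_matrix (A B : Matrix n n ℂ) (x y : n → ℂ) :
    sesqForm (A - B) x y = sesqForm A x y - sesqForm B x y := by
  simp [sesqForm, sub_mulVec, dotProduct_sub]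

theorem re_sesqForm_vecMulVec (l x : n → ℂ) :
    (sesqForm (vecMulVec l (star l)) x x).re = ‖star l ⬝ᵥ x‖ ^ 2 := by
  have h : sesqForm (vecMulVec l (star l)) x x = star (star l ⬝ᵥ x) * (star l ⬝ᵥ x) := by
    rw [sesqForm, vecMulVec_mulVec, dotProduct_smul, op_smul_eq_smul, smul_eq_mul,
      mul_comm, star_dotProduct x l]
  rw [h, Complex.star_def, ← Complex.normSq_eq_conj_mul_self, Complex.ofReal_re,
    Complex.normSq_eq_norm_sq]

theorem re_sesqForm_diagonal [DecidableEq n] (t : n → ℝ) (x : n → ℂ) :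
    (sesqForm (diagonal fun i => (t i : ℂ)) x x).re = ∑ i, t i * ‖x i‖ ^ 2 := by
  rw [sesqForm, dotProduct, Complex.re_sum]
  refine Finset.sum_congr rfl fun i _ => ?_
  rw [mulVec_diagonal, Pi.star_apply, mul_left_comm, Complex.re_ofReal_mul, Complex.star_def,
    ← Complex.normSq_eq_conj_mul_self, Complex.ofReal_re, Complex.normSq_eq_norm_sq]

/-- Where `l` and `m` vanish, the form is minus a sum of squares; `hker` says that these squares
have no common nontrivial zero there. -/
theorem eigenvalues₀_neg_of_decomposition [DecidableEq n] {A : Matrix n n ℂ} (hA : A.IsHermitian)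
    (h2 : 2 < Fintype.card n) (l m d r : n → ℂ) (t : n → ℝ) (ht : ∀ i, 0 ≤ t i)
    (hdec : A = vecMulVec l (star l) + vecMulVec m (star m) - vecMulVec d (star d)
      - vecMulVec r (star r) - diagonal fun i => (t i : ℂ))
    (hker : ∀ x, star l ⬝ᵥ x = 0 → star m ⬝ᵥ x = 0 → star d ⬝ᵥ x = 0 → star r ⬝ᵥ x = 0 →
      (∀ i, t i ≠ 0 → x i = 0) → x = 0) :
    hA.eigenvalues₀ ⟨2, h2⟩ < 0 := by
  refine eigenvalues₀_neg_of_sesqForm_neg hA h2 (star l) (star m) fun x hx hl hm => ?_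
  by_contra! hpos
  have hval : (sesqForm A x x).re
      = -‖star d ⬝ᵥ x‖ ^ 2 - ‖star r ⬝ᵥ x‖ ^ 2 - ∑ i, t i * ‖x i‖ ^ 2 := by
    rw [hdec]
    simp only [sesqForm_sub_matrix, sesqForm_add_matrix, Complex.sub_re, Complex.add_re,
      re_sesqForm_vecMulVec, re_sesqForm_diagonal, hl, hm]
    simp
  have hn : ∀ i, 0 ≤ t i * ‖x i‖ ^ 2 := fun i => mul_nonneg (ht i) (sq_nonneg _)
  have hs : 0 ≤ ∑ i, t i * ‖x i‖ ^ 2 := Finset.sum_nonneg fun i _ => hn i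
  have hd2 := sq_nonneg ‖star d ⬝ᵥ x‖
  have hr2 := sq_nonneg ‖star r ⬝ᵥ x‖
  refine hx (hker x hl hm ?_ ?_ fun i hi => ?_)
  · rw [← norm_eq_zero, ← sq_eq_zero_iff]; linarith
  · rw [← norm_eq_zero, ← sq_eq_zero_iff]; linarith
  · have h0 : ∑ i, t i * ‖x i‖ ^ 2 = 0 := by linarith
    have := (Finset.sum_eq_zero_iff_of_nonneg fun i _ => hn i).mp h0 i (Finset.mem_univ i)
    simpa [hi] using this

end Decomposition

/-! ### Arithmetic of `ω` and spectral invariance under switching isomorphism -/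

theorem sixthRoot_sq : sixthRoot ^ 2 = sixthRoot - 1 := by
  have h3 : ((Real.sqrt 3 : ℝ) : ℂ) ^ 2 = 3 := by
    have h : (Real.sqrt 3) ^ 2 = 3 := Real.sq_sqrt (by norm_num)
    exact_mod_cast h
  unfold sixthRoot
  linear_combination (1 / 4 : ℂ) * Complex.I ^ 2 * h3 + (3 / 4 : ℂ) * Complex.I_sq

theorem sixthRoot_ne_zero : sixthRoot ≠ 0 := fun h => by
  simpa [h] using sixthRoot_pow_six

theorem sixthRoot_inv : sixthRoot⁻¹ = 1 - sixthRoot := by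
  rw [inv_eq_of_mul_eq_one_right]
  linear_combination -sixthRoot_sq

theorem star_sixthRoot : star sixthRoot = 1 - sixthRoot := by
  rw [star_eq_inv_of_mem_gainSet sixthRoot_mem_gainSet, sixthRoot_inv]

theorem ne_zero_of_mem_gainSet {z : ℂ} (hz : z ∈ gainSet) : z ≠ 0 := by
  obtain ⟨k, rfl⟩ := hz
  exact pow_ne_zero _ sixthRoot_ne_zero

namespace SignedDigraph

variable {V : Type*}

theorem eisensteinMatrix_adj (Φ : SignedDigraph V) {u v : V} (h : Φ.graph.Adj u v) :
    Φ.eisensteinMatrix u v = Φ.gain ⟨(u, v), h⟩ := by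
  simp [eisensteinMatrix, h]

theorem eisensteinMatrix_not_adj (Φ : SignedDigraph V) {u v : V} (h : ¬ Φ.graph.Adj u v) :
    Φ.eisensteinMatrix u v = 0 := by
  simp [eisensteinMatrix, h]

theorem eisensteinMatrix_converse (Φ : SignedDigraph V) :
    Φ.converse.eisensteinMatrix = Φ.eisensteinMatrixᵀ := by
  ext u v
  rw [transpose_apply]
  by_cases h : Φ.graph.Adj u v
  · rw [eisensteinMatrix_adj Φ h.symm, eisensteinMatrix_adj Φ.converse h]
    rfl
  · rw [eisensteinMatrix_not_adj Φ fun h' => h h'.symm, eisensteinMatrix_not_adj Φ.converse h]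

variable [Fintype V] [DecidableEq V]

/-- The ordered eigenvalues are the sorted roots of the characteristic polynomial, so comparing
characteristic polynomials is enough. -/
theorem eigenvalue_congr {Φ Ψ : SignedDigraph V}
    (h : Φ.eisensteinMatrix.charpoly = Ψ.eisensteinMatrix.charpoly) :
    Φ.eigenvalue = Ψ.eigenvalue := by
  change Φ.isHermitian_eisensteinMatrix.eigenvalues₀ = Ψ.isHermitian_eisensteinMatrix.eigenvalues₀
  rw [← List.ofFn_inj, ← Matrix.IsHermitian.sort_roots_charpoly_eq_eigenvalues₀,
    ← Matrix.IsHermitian.sort_roots_charpoly_eq_eigenvalues₀, h]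

theorem IsGainSwitching.charpoly_eq {Φ Ψ : SignedDigraph V} (h : IsGainSwitching Φ Ψ) :
    Φ.eisensteinMatrix.charpoly = Ψ.eisensteinMatrix.charpoly := by
  obtain ⟨x, hx, h⟩ := h
  have hu : IsUnit (diagonal x).det := by
    rw [det_diagonal, isUnit_iff_ne_zero]
    exact Finset.prod_ne_zero_iff.mpr fun v _ => ne_zero_of_mem_gainSet (hx v)
  rw [h, charpoly_mul_comm, ← mul_assoc, nonsing_inv_mul _ hu, one_mul]

theorem IsRelabeling.charpoly_eq {Φ Ψ : SignedDigraph V} (h : IsRelabeling Φ Ψ) :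
    Φ.eisensteinMatrix.charpoly = Ψ.eisensteinMatrix.charpoly := by
  obtain ⟨σ, h⟩ := h
  rw [h, ← charpoly_reindex σ.symm, reindex_apply, Equiv.symm_symm]

theorem SwitchingIsomorphic.eigenvalue_eq {Φ Ψ : SignedDigraph V} (h : SwitchingIsomorphic Φ Ψ) :
    Φ.eigenvalue = Ψ.eigenvalue := by
  obtain ⟨Θ, hΘ, h⟩ := h
  have h1 : Φ.eisensteinMatrix.charpoly = Θ.eisensteinMatrix.charpoly := by
    clear h
    induction hΘ with
    | refl => rfl
    | tail _ hs ih => exact ih.trans (hs.elim IsGainSwitching.charpoly_eq IsRelabeling.charpoly_eq)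
  refine eigenvalue_congr (h1.trans ?_)
  rcases h with rfl | rfl
  · rfl
  -- The converse transposes the matrix.
  · rw [eisensteinMatrix_converse, charpoly_transpose]

end SignedDigraph

/-! ### Test vectors supported on a few vertices -/

section PrincipalSubmatrix

variable {n : Type*} [Fintype n] [DecidableEq n]

theorem sesqForm_submatrix (A : Matrix n n ℂ) {m : ℕ} (e : Fin m → n) (f g : Fin m → ℂ) :
    sesqForm (A.submatrix e e) f g =
      sesqForm A ((1 : Matrix n n ℂ).submatrix id e *ᵥ f)
        ((1 : Matrix n n ℂ).submatrix id e *ᵥ g) := by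
  rw [sesqForm, sesqForm, star_mulVec, ← dotProduct_mulVec, mulVec_mulVec, mulVec_mulVec]
  congr 2
  ext k l
  simp [Matrix.mul_apply, Matrix.one_apply]

/-- Test vectors on `Fin m` are pushed forward along `e`. The pushforward of `h` must be nonzero,
for which it is enough that one index with `h k ≠ 0` is the only one sent to its vertex; full
injectivity of `e` is not needed. -/
theorem sesqForm_neg_of_principal_submatrix {A : Matrix n n ℂ} (hA : A.IsHermitian)
    (h2 : 2 < Fintype.card n) (hneg : hA.eigenvalues₀ ⟨2, h2⟩ < 0) {m : ℕ} (e : Fin m → n)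
    {B : Matrix (Fin m) (Fin m) ℂ} (hB : ∀ k l, A (e k) (e l) = B k l) {f g h : Fin m → ℂ}
    (hfg : sesqForm B f g = 0) (hfh : sesqForm B f h = 0) (hgh : sesqForm B g h = 0)
    (hf : 0 < (sesqForm B f f).re) (hg : 0 < (sesqForm B g g).re)
    (k : Fin m) (hk : ∀ l, e l = e k → l = k) (h0 : h k ≠ 0) :
    (sesqForm B h h).re < 0 := by
  obtain rfl : A.submatrix e e = B := by ext k l; exact hB k l
  rw [sesqForm_submatrix] at *
  refine sesqForm_neg_of_eigenvalues₀_neg hA h2 hneg hfg hfh hgh hf hg fun hz => h0 ?_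
  have := congrFun hz (e k)
  rw [mulVec, dotProduct, Finset.sum_eq_single k] at this
  · simpa [Matrix.one_apply] using this
  · intro l _ hl
    have : e k ≠ e l := fun h => hl (hk l h.symm)
    simp [this]
  · simp

end PrincipalSubmatrix

/-! ### Normalized bridge matrices -/

theorem mul_conj_of_mem_gainSet {z : ℂ} (hz : z ∈ gainSet) : z * conj z = 1 := by
  rw [← Complex.star_def, star_eq_inv_of_mem_gainSet hz, mul_inv_cancel₀ (ne_zero_of_mem_gainSet hz)]

theorem sixthRoot_re : sixthRoot.re = 1 / 2 := by
  have h := congrArg Complex.re star_sixthRoot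
  simp at h
  linarith

theorem eq_of_mem_gainSet_of_re_pos {z : ℂ} (hz : z ∈ gainSet) (h : 0 < z.re) :
    z = 1 ∨ z = sixthRoot ∨ z = 1 - sixthRoot := by
  obtain ⟨k, rfl⟩ := hz
  rw [← Nat.mod_add_div k 6, pow_add, pow_mul, sixthRoot_pow_six, one_pow, mul_one] at h ⊢
  have h4 : sixthRoot ^ 4 = -sixthRoot := by linear_combination sixthRoot * sixthRoot_cube
  have h5 : sixthRoot ^ 5 = 1 - sixthRoot := by
    linear_combination sixthRoot ^ 2 * sixthRoot_cube - sixthRoot_sq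
  have hr := sixthRoot_re
  have hk : k % 6 < 6 := Nat.mod_lt _ (by norm_num)
  interval_cases k % 6
  · simp
  · simp
  · rw [sixthRoot_sq, Complex.sub_re, hr] at h
    norm_num at h
  · rw [sixthRoot_cube] at h
    norm_num at h
  · rw [h4, Complex.neg_re, hr] at h
    norm_num at h
  · exact Or.inr (Or.inr h5)

/-- A Hermitian matrix with the shape of a normalized bridge of two cliques `P ∪ {a}` and
`Q ∪ {b}`, joined by the edge `ab`: the only gains that need not be `1` are inside `P` and `Q`. -/
structure IsBridgeMatrix {n : Type*} (M : Matrix n n ℂ) (P : Set n) (a b : n) (Q : Set n) :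
    Prop where
  isHermitian : M.IsHermitian
  diag : ∀ i, M i i = 0
  gain_left : ∀ i ∈ P, ∀ j ∈ P, i ≠ j → M i j ∈ gainSet
  gain_right : ∀ s ∈ Q, ∀ t ∈ Q, s ≠ t → M s t ∈ gainSet
  left_fst : ∀ i ∈ P, M i a = 1
  fst_snd : M a b = 1
  right_snd : ∀ s ∈ Q, M s b = 1
  left_right : ∀ i ∈ P, ∀ s ∈ Q, M i s = 0
  left_snd : ∀ i ∈ P, M i b = 0
  right_fst : ∀ s ∈ Q, M s a = 0

namespace IsBridgeMatrix

variable {n : Type*} {M : Matrix n n ℂ} {P Q : Set n} {a b : n}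

theorem swap (hM : IsBridgeMatrix M P a b Q) (u v : n) : M v u = conj (M u v) :=
  (hM.isHermitian.apply v u).symm

theorem symm (hM : IsBridgeMatrix M P a b Q) : IsBridgeMatrix M Q b a P where
  isHermitian := hM.isHermitian
  diag := hM.diag
  gain_left := hM.gain_right
  gain_right := hM.gain_left
  left_fst := hM.right_snd
  fst_snd := by rw [hM.swap a b, hM.fst_snd, map_one]
  right_snd := hM.left_fst
  left_right := fun s hs i hi => by rw [hM.swap i s, hM.left_right i hi s hs, map_zero]
  left_snd := hM.right_fst
  right_fst := hM.left_snd

theorem ne_of_left_right (hM : IsBridgeMatrix M P a b Q) {i s : n} (hi : i ∈ P) (hs : s ∈ Q) :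
    i ≠ s := by
  rintro rfl
  simpa [hM.left_snd i hi] using hM.right_snd i hs

theorem ne_fst (hM : IsBridgeMatrix M P a b Q) {i : n} (hi : i ∈ P) : i ≠ a := by
  rintro rfl
  simpa [hM.diag i] using hM.left_fst i hi

theorem fst_ne_snd (hM : IsBridgeMatrix M P a b Q) : a ≠ b := by
  rintro rfl
  simpa [hM.diag a] using hM.fst_snd

theorem right_ne_fst (hM : IsBridgeMatrix M P a b Q) {i s : n} (hi : i ∈ P) (hs : s ∈ Q) :
    s ≠ a := by
  rintro rfl
  simpa [hM.left_right i hi s hs] using hM.left_fst i hi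

end IsBridgeMatrix

/-! ### Inequalities for the gains from small principal submatrices -/

namespace IsBridgeMatrix

variable {n : Type*} [Fintype n] [DecidableEq n] {M : Matrix n n ℂ} {P Q : Set n} {a b : n}

/-- Eliminating the edges `ij` and `st` leaves on `a, b` the Schur complement with diagonal `-2 Re
g`, `-2 Re k` and off-diagonal `1`. Its form at `(α, β)` must be negative. -/
theorem gain_re_bound (hM : IsBridgeMatrix M P a b Q) (h2 : 2 < Fintype.card n)
    (hneg : hM.isHermitian.eigenvalues₀ ⟨2, h2⟩ < 0) {i j s t : n} (hi : i ∈ P) (hj : j ∈ P)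
    (hij : i ≠ j) (hs : s ∈ Q) (ht : t ∈ Q) (hst : s ≠ t) (α β : ℝ) (hα : α ≠ 0) :
    α * β < α ^ 2 * (M i j).re + β ^ 2 * (M s t).re := by
  have hg := mul_conj_of_mem_gainSet (hM.gain_left i hi j hj hij)
  have hk := mul_conj_of_mem_gainSet (hM.gain_right s hs t ht hst)
  have hji := hM.swap i j
  have hts := hM.swap s t
  have hN := hM.symm
  set g := M i j with hgdef
  set k := M s t with hkdef
  have key := sesqForm_neg_of_principal_submatrix hM.isHermitian h2 hneg ![i, j, a, b, s, t]
    (B := !![0, g, 1, 0, 0, 0; conj g, 0, 1, 0, 0, 0; 1, 1, 0, 1, 0, 0; 0, 0, 1, 0, 1, 1;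
      0, 0, 0, 1, 0, k; 0, 0, 0, 1, conj k, 0])
    (by
      intro x y
      fin_cases x <;> fin_cases y <;>
        simp [hM.diag, hji, hts, ← hgdef, ← hkdef, hM.left_fst, hM.fst_snd, hM.right_snd,
          hM.left_right, hM.left_snd, hM.right_fst, hi, hj, hs, ht, hM.swap i a, hM.swap j a,
          hM.swap s b, hM.swap t b, hN.left_right, hN.fst_snd, hM.swap i b, hM.swap j b,
          hM.swap s a, hM.swap t a])
    (f := ![1, conj g, 0, 0, 0, 0]) (g := ![0, 0, 0, 0, 1, conj k])
    -- The block of the edge `ij` sends `(g, conj g)` to `(1, 1)`. Thus these entries cancel the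
    -- contributions of `α` at `i, j`, and similarly those of `β` at `s, t`.
    (h := ![-α * g, -α * conj g, α, β, -β * k, -β * conj k])
    (by simp [sesqForm, mulVec, dotProduct, Fin.sum_univ_succ])
    (by
      simp [sesqForm, mulVec, dotProduct, Fin.sum_univ_succ] at hg ⊢
      linear_combination (-α * g - α) * hg)
    (by
      simp [sesqForm, mulVec, dotProduct, Fin.sum_univ_succ] at hk ⊢
      linear_combination (-β * k - β) * hk)
    (by
      have : sesqForm !![0, g, 1, 0, 0, 0; conj g, 0, 1, 0, 0, 0; 1, 1, 0, 1, 0, 0;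
          0, 0, 1, 0, 1, 1; 0, 0, 0, 1, 0, k; 0, 0, 0, 1, conj k, 0]
          ![1, conj g, 0, 0, 0, 0] ![1, conj g, 0, 0, 0, 0] = 2 := by
        simp [sesqForm, mulVec, dotProduct, Fin.sum_univ_succ] at hg ⊢
        linear_combination 2 * hg
      rw [this]
      norm_num)
    (by
      have : sesqForm !![0, g, 1, 0, 0, 0; conj g, 0, 1, 0, 0, 0; 1, 1, 0, 1, 0, 0;
          0, 0, 1, 0, 1, 1; 0, 0, 0, 1, 0, k; 0, 0, 0, 1, conj k, 0]
          ![0, 0, 0, 0, 1, conj k] ![0, 0, 0, 0, 1, conj k] = 2 := by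
        simp [sesqForm, mulVec, dotProduct, Fin.sum_univ_succ] at hk ⊢
        linear_combination 2 * hk
      rw [this]
      norm_num)
    2
    (by
      intro l hl
      fin_cases l
      · exact absurd hl (hM.ne_fst hi)
      · exact absurd hl (hM.ne_fst hj)
      · rfl
      · exact absurd hl.symm hM.fst_ne_snd
      · exact absurd hl (hM.right_ne_fst hi hs)
      · exact absurd hl (hM.right_ne_fst hi ht))
    (by simpa using hα)
  have hval : sesqForm !![0, g, 1, 0, 0, 0; conj g, 0, 1, 0, 0, 0; 1, 1, 0, 1, 0, 0;
      0, 0, 1, 0, 1, 1; 0, 0, 0, 1, 0, k; 0, 0, 0, 1, conj k, 0]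
      ![-α * g, -α * conj g, α, β, -β * k, -β * conj k]
      ![-α * g, -α * conj g, α, β, -β * k, -β * conj k]
      = (2 * α * β : ℝ) - (α ^ 2 : ℝ) * (g + conj g) - (β ^ 2 : ℝ) * (k + conj k) := by
    simp [sesqForm, mulVec, dotProduct, Fin.sum_univ_succ] at hg hk ⊢
    linear_combination (α ^ 2 * (g + conj g)) * hg + (β ^ 2 * (k + conj k)) * hk
  rw [hval] at key
  simp only [Complex.sub_re, Complex.re_ofReal_mul, Complex.ofReal_re, Complex.add_re,
    Complex.conj_re] at key
  linarith

/-- Eliminating the edge `ij` from the triangle leaves at `k` the Schur complement `-2 Re (g c conj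
h)`, where `g`, `c`, `h` are the gains of `ij`, `jk`, `ik`. -/
theorem triangle_re_pos (hM : IsBridgeMatrix M P a b Q) (h2 : 2 < Fintype.card n)
    (hneg : hM.isHermitian.eigenvalues₀ ⟨2, h2⟩ < 0) {i j k s t : n} (hi : i ∈ P) (hj : j ∈ P)
    (hk : k ∈ P) (hij : i ≠ j) (hik : i ≠ k) (hjk : j ≠ k) (hs : s ∈ Q) (ht : t ∈ Q)
    (hst : M s t = 1) :
    0 < (M i j * M j k * M k i).re := by
  have hg := mul_conj_of_mem_gainSet (hM.gain_left i hi j hj hij)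
  have hh := mul_conj_of_mem_gainSet (hM.gain_left i hi k hk hik)
  have hc := mul_conj_of_mem_gainSet (hM.gain_left j hj k hk hjk)
  have hji := hM.swap i j
  have hkj := hM.swap j k
  have hki := hM.swap i k
  have hts := hM.swap s t
  have hN := hM.symm
  rw [hki]
  set g := M i j with hgdef
  set h := M i k with hhdef
  set c := M j k with hcdef
  have key := sesqForm_neg_of_principal_submatrix hM.isHermitian h2 hneg ![i, j, k, s, t]
    (B := !![0, g, h, 0, 0; conj g, 0, c, 0, 0; conj h, conj c, 0, 0, 0; 0, 0, 0, 0, 1;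
      0, 0, 0, 1, 0])
    (by
      intro x y
      fin_cases x <;> fin_cases y <;>
        simp [hM.diag, hji, hts, hki, hkj, ← hgdef, ← hhdef, ← hcdef, hst,
          hM.left_right, hi, hj, hk, hs, ht, hN.left_right])
    (f := ![1, conj g, 0, 0, 0]) (g := ![0, 0, 0, 1, 1])
    (h := ![g * c, h * conj g, -1, 0, 0])
    (by simp [sesqForm, mulVec, dotProduct, Fin.sum_univ_succ])
    (by
      simp [sesqForm, mulVec, dotProduct, Fin.sum_univ_succ] at hg ⊢
      linear_combination (h + g * c) * hg)
    (by simp [sesqForm, mulVec, dotProduct, Fin.sum_univ_succ])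
    (by
      have : sesqForm !![0, g, h, 0, 0; conj g, 0, c, 0, 0; conj h, conj c, 0, 0, 0;
          0, 0, 0, 0, 1; 0, 0, 0, 1, 0] ![1, conj g, 0, 0, 0] ![1, conj g, 0, 0, 0] = 2 := by
        simp [sesqForm, mulVec, dotProduct, Fin.sum_univ_succ] at hg ⊢
        linear_combination 2 * hg
      rw [this]
      norm_num)
    (by simp [sesqForm, mulVec, dotProduct, Fin.sum_univ_succ])
    2
    (by
      intro l hl
      fin_cases l
      · exact absurd hl hik
      · exact absurd hl hjk
      · rfl
      · exact absurd hl.symm (hM.ne_of_left_right hk hs)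
      · exact absurd hl.symm (hM.ne_of_left_right hk ht))
    (by simp)
  have hval : sesqForm !![0, g, h, 0, 0; conj g, 0, c, 0, 0; conj h, conj c, 0, 0, 0;
      0, 0, 0, 0, 1; 0, 0, 0, 1, 0] ![g * c, h * conj g, -1, 0, 0] ![g * c, h * conj g, -1, 0, 0]
      = -(g * c * conj h + conj (g * c * conj h)) := by
    simp [sesqForm, mulVec, dotProduct, Fin.sum_univ_succ] at hg hh hc ⊢
    linear_combination (conj h * g * c + h * conj g * conj c) * hg
  rw [hval, Complex.neg_re, Complex.add_re, Complex.conj_re] at key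
  linarith

/-- Let `D` be the determinant of the triangle block and `N` the sum of its cofactors. Eliminating
the triangle and then `b, s, t` leaves at `a` the Schur complement `1 / 2 - N / D`; it must be
negative, and `D > 0`. -/
theorem triangle_cofactor_neg (hM : IsBridgeMatrix M P a b Q) (h2 : 2 < Fintype.card n)
    (hneg : hM.isHermitian.eigenvalues₀ ⟨2, h2⟩ < 0) {i j k s t : n} (hi : i ∈ P) (hj : j ∈ P)
    (hk : k ∈ P) (hij : i ≠ j) (hik : i ≠ k) (hjk : j ≠ k) (hs : s ∈ Q) (ht : t ∈ Q)
    (hst : M s t = 1) :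
    (M i j * M j k * M k i).re <
      2 * ((M i k * M k j).re + (M i j * M j k).re + (M j i * M i k).re) - 3 := by
  have hD := hM.triangle_re_pos h2 hneg hi hj hk hij hik hjk hs ht hst
  have hg := mul_conj_of_mem_gainSet (hM.gain_left i hi j hj hij)
  have hh := mul_conj_of_mem_gainSet (hM.gain_left i hi k hk hik)
  have hc := mul_conj_of_mem_gainSet (hM.gain_left j hj k hk hjk)
  have hji := hM.swap i j
  have hkj := hM.swap j k
  have hki := hM.swap i k
  have hts := hM.swap s t
  have hN := hM.symm
  rw [hki] at hD ⊢
  rw [hji, hkj]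
  set g := M i j with hgdef
  set h := M i k with hhdef
  set c := M j k with hcdef
  obtain ⟨D, hDdef⟩ : ∃ D : ℂ, D = g * c * conj h + conj (g * c * conj h) := ⟨_, rfl⟩
  obtain ⟨N, hNdef⟩ : ∃ N : ℂ, N = h * conj c + conj (h * conj c) + (g * c + conj (g * c))
      + (conj g * h + conj (conj g * h)) - 3 := ⟨_, rfl⟩
  have hDr : D = (2 * (g * c * conj h).re : ℝ) := by rw [hDdef, Complex.add_conj]
  have hNr : N = (2 * ((h * conj c).re + (g * c).re + (conj g * h).re) - 3 : ℝ) := by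
    rw [hNdef, Complex.add_conj, Complex.add_conj, Complex.add_conj]
    push_cast
    ring
  obtain ⟨B, hB⟩ : ∃ B : Matrix (Fin 7) (Fin 7) ℂ,
      B = !![0, g, h, 1, 0, 0, 0; conj g, 0, c, 1, 0, 0, 0;
        conj h, conj c, 0, 1, 0, 0, 0; 1, 1, 1, 0, 1, 0, 0; 0, 0, 0, 1, 0, 1, 1;
        0, 0, 0, 0, 1, 0, 1; 0, 0, 0, 0, 1, 1, 0] := ⟨_, rfl⟩
  -- `-2` times the adjugate of the triangle block applied to `(1, 1, 1)`, followed by multiples of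
  -- `D` solving the rows of `b, s, t`. Only the row of `a` survives in `B *ᵥ w`, so `w` is
  -- orthogonal to every vector that vanishes at `a`.
  obtain ⟨w, hw⟩ : ∃ w : Fin 7 → ℂ, w = ![-2 * (h * conj c + g * c - 1),
      -2 * (conj h * c + h * conj g - 1), -2 * (conj g * conj c + g * conj h - 1),
      2 * D, D, -D, -D] := ⟨_, rfl⟩
  have hBw : B *ᵥ w = ![0, 0, 0, D - 2 * N, 0, 0, 0] := by
    rw [hB, hw]
    ext x
    fin_cases x <;> simp [mulVec, dotProduct, Fin.sum_univ_succ] at hDdef hNdef hg hh hc ⊢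
    · linear_combination (2 : ℂ) * hDdef - 2 * h * hg - 2 * g * hh
    · linear_combination (2 : ℂ) * hDdef - 2 * c * hg - 2 * conj g * hc
    · linear_combination (2 : ℂ) * hDdef - 2 * conj c * hh - 2 * conj h * hc
    · linear_combination (2 : ℂ) * hNdef
    · ring
  have key := sesqForm_neg_of_principal_submatrix hM.isHermitian h2 hneg ![i, j, k, a, b, s, t]
    (B := B)
    (by
      rw [hB]
      intro x y
      fin_cases x <;> fin_cases y <;>
        simp [hM.diag, hji, hts, hki, hkj, ← hgdef, ← hhdef, ← hcdef, hst,
          hM.left_right, hi, hj, hk, hs, ht, hN.left_right, hM.left_fst, hM.fst_snd, hM.right_snd,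
          hM.left_snd, hM.right_fst, hM.swap i a, hM.swap j a, hM.swap k a,
          hM.swap s b, hM.swap t b, hN.fst_snd, hM.swap i b, hM.swap j b, hM.swap k b,
          hM.swap s a, hM.swap t a])
    (f := ![1, conj g, 0, 0, 0, 0, 0]) (g := ![0, 0, 0, 0, 0, 1, 1]) (h := w)
    (by simp [hB, sesqForm, mulVec, dotProduct, Fin.sum_univ_succ])
    (by
      rw [sesqForm, hBw]
      simp [dotProduct, Fin.sum_univ_succ])
    (by
      rw [sesqForm, hBw]
      simp [dotProduct, Fin.sum_univ_succ])
    (by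
      have : sesqForm B ![1, conj g, 0, 0, 0, 0, 0] ![1, conj g, 0, 0, 0, 0, 0] = 2 := by
        simp [hB, sesqForm, mulVec, dotProduct, Fin.sum_univ_succ] at hg ⊢
        linear_combination 2 * hg
      rw [this]
      norm_num)
    (by simp [hB, sesqForm, mulVec, dotProduct, Fin.sum_univ_succ])
    3
    (by
      intro l hl
      fin_cases l
      · exact absurd hl (hM.ne_fst hi)
      · exact absurd hl (hM.ne_fst hj)
      · exact absurd hl (hM.ne_fst hk)
      · rfl
      · exact absurd hl.symm hM.fst_ne_snd
      · exact absurd hl (hM.right_ne_fst hi hs)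
      · exact absurd hl (hM.right_ne_fst hi ht))
    (by
      have hD0 : D ≠ 0 := by
        rw [hDr]
        exact Complex.ofReal_ne_zero.mpr (by linarith)
      simpa [hw] using hD0)
  have hval : sesqForm B w w = 2 * conj D * (D - 2 * N) := by
    rw [sesqForm, hBw, hw]
    simp [dotProduct, Fin.sum_univ_succ, map_ofNat (starRingEnd ℂ) 2]
  have hval' : sesqForm B w w = ((2 * (2 * (g * c * conj h).re) * (2 * (g * c * conj h).re -
      2 * (2 * ((h * conj c).re + (g * c).re + (conj g * h).re) - 3)) : ℝ) : ℂ) := by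
    rw [hval, hDr, hNr, Complex.conj_ofReal]
    push_cast
    ring
  rw [hval', Complex.ofReal_re] at key
  nlinarith [key, hD]

end IsBridgeMatrix

theorem sixthRoot_ne_one : sixthRoot ≠ 1 := fun h => by
  have := sixthRoot_re
  rw [h] at this
  norm_num at this

theorem conj_sixthRoot : conj sixthRoot = 1 - sixthRoot := star_sixthRoot

theorem sixthRoot_im_sq : sixthRoot.im * sixthRoot.im = 3 / 4 := by
  have h := congrArg Complex.re sixthRoot_sq
  rw [sq, Complex.mul_re, Complex.sub_re, sixthRoot_re, Complex.one_re] at h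
  linarith

/-! ### At most one arc in the two cliques -/

namespace IsBridgeMatrix

variable {n : Type*} [Fintype n] [DecidableEq n] {M : Matrix n n ℂ} {P Q : Set n} {a b : n}

theorem gain_left_cases (hM : IsBridgeMatrix M P a b Q) (h2 : 2 < Fintype.card n)
    (hneg : hM.isHermitian.eigenvalues₀ ⟨2, h2⟩ < 0) {i j s t : n} (hi : i ∈ P) (hj : j ∈ P)
    (hij : i ≠ j) (hs : s ∈ Q) (ht : t ∈ Q) (hst : s ≠ t) :
    M i j = 1 ∨ M i j = sixthRoot ∨ M i j = 1 - sixthRoot := by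
  refine eq_of_mem_gainSet_of_re_pos (hM.gain_left i hi j hj hij) ?_
  -- The weights `1, 0` isolate the real part of `M i j`.
  have := hM.gain_re_bound h2 hneg hi hj hij hs ht hst 1 0 one_ne_zero
  linarith

/-- Among `1`, `ω`, `ω⁻¹` the two triangle inequalities exclude every other choice. Some choices
give equality in the cofactor bound, so its strictness matters. -/
theorem triangle_gains (hM : IsBridgeMatrix M P a b Q) (h2 : 2 < Fintype.card n)
    (hneg : hM.isHermitian.eigenvalues₀ ⟨2, h2⟩ < 0) {i j k s t : n} (hi : i ∈ P) (hj : j ∈ P)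
    (hk : k ∈ P) (hij : i ≠ j) (hik : i ≠ k) (hjk : j ≠ k) (hs : s ∈ Q) (ht : t ∈ Q)
    (hne : s ≠ t) (hst : M s t = 1) (h1 : M i j ≠ 1) : M i k = 1 ∧ M j k = 1 := by
  have hD := hM.triangle_re_pos h2 hneg hi hj hk hij hik hjk hs ht hst
  have hN := hM.triangle_cofactor_neg h2 hneg hi hj hk hij hik hjk hs ht hst
  rw [hM.swap i k] at hD hN
  rw [hM.swap i j, hM.swap j k] at hN
  have hy := sixthRoot_im_sq
  have hx := sixthRoot_re
  rcases hM.gain_left_cases h2 hneg hi hj hij hs ht hne with hg | hg | hg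
  · exact absurd hg h1
  all_goals
    rcases hM.gain_left_cases h2 hneg hi hk hik hs ht hne with hh | hh | hh <;>
    rcases hM.gain_left_cases h2 hneg hj hk hjk hs ht hne with hc | hc | hc
    · exact ⟨hh, hc⟩
    all_goals
      exfalso
      rw [hg, hh, hc] at hD hN
      simp [hx] at hD hN
      nlinarith [hD, hN, hy]

/-- With `W` the block of one arc and `J` the all-ones block, the four vertices carry the matrix
with rows `W, J` and `J, W`. The vector `x = (ω - 1, 1)` satisfies `W x = J x`, so `(x, -x)` is a
null vector; it is orthogonal to everything and its form is `0`, not negative. -/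
theorem not_two_disjoint_arcs (hM : IsBridgeMatrix M P a b Q) (h2 : 2 < Fintype.card n)
    (hneg : hM.isHermitian.eigenvalues₀ ⟨2, h2⟩ < 0) {i j k l s t : n} (hi : i ∈ P) (hj : j ∈ P)
    (hk : k ∈ P) (hl : l ∈ P) (hij : i ≠ j) (hik : i ≠ k) (hil : i ≠ l) (hs : s ∈ Q) (ht : t ∈ Q)
    (hst : M s t = 1) (hg : M i j = sixthRoot) (hh : M k l = sixthRoot) (h1 : M i k = 1)
    (h2' : M i l = 1) (h3 : M j k = 1) (h4 : M j l = 1) : False := by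
  have hts := hM.swap s t
  have hN := hM.symm
  have hsq := sixthRoot_sq
  obtain ⟨B, hB⟩ : ∃ B : Matrix (Fin 6) (Fin 6) ℂ,
      B = !![0, sixthRoot, 1, 1, 0, 0; 1 - sixthRoot, 0, 1, 1, 0, 0; 1, 1, 0, sixthRoot, 0, 0;
        1, 1, 1 - sixthRoot, 0, 0, 0; 0, 0, 0, 0, 0, 1; 0, 0, 0, 0, 1, 0] := ⟨_, rfl⟩
  have hBw : B *ᵥ ![sixthRoot - 1, 1, 1 - sixthRoot, -1, 0, 0] = 0 := by
    rw [hB]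
    ext x
    fin_cases x <;> simp [mulVec, dotProduct, Fin.sum_univ_succ]
    · ring
    · linear_combination -hsq
    · ring
    · linear_combination hsq
  have key := sesqForm_neg_of_principal_submatrix hM.isHermitian h2 hneg ![i, j, k, l, s, t]
    (B := B)
    (by
      rw [hB]
      intro x y
      fin_cases x <;> fin_cases y <;>
        simp [hM.diag, hM.swap i j, hM.swap i k, hM.swap i l, hM.swap j k, hM.swap j l,
          hM.swap k l, hg, hh, h1, h2', h3, h4, hts, hst, conj_sixthRoot, hM.left_right, hi, hj, hk,
          hl, hs, ht, hN.left_right])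
    (f := ![1, 1 - sixthRoot, 0, 0, 0, 0]) (g := ![0, 0, 0, 0, 1, 1])
    (h := ![sixthRoot - 1, 1, 1 - sixthRoot, -1, 0, 0])
    (by simp [hB, sesqForm, mulVec, dotProduct, Fin.sum_univ_succ])
    (by simp [sesqForm, hBw])
    (by simp [sesqForm, hBw])
    (by
      have : sesqForm B ![1, 1 - sixthRoot, 0, 0, 0, 0] ![1, 1 - sixthRoot, 0, 0, 0, 0] = 2 := by
        simp [hB, sesqForm, mulVec, dotProduct, Fin.sum_univ_succ, conj_sixthRoot]
        linear_combination (-2 : ℂ) * hsq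
      rw [this]
      norm_num)
    (by simp [hB, sesqForm, mulVec, dotProduct, Fin.sum_univ_succ])
    0
    (by
      intro x hx
      fin_cases x
      · rfl
      · exact absurd hx.symm hij
      · exact absurd hx.symm hik
      · exact absurd hx.symm hil
      · exact absurd hx.symm (hM.ne_of_left_right hi hs)
      · exact absurd hx.symm (hM.ne_of_left_right hi ht))
    (by simpa [sub_eq_zero] using sixthRoot_ne_one)
  simp [sesqForm, hBw] at key

/-- All gains between distinct vertices of `S` are `1`, up to one positive arc from `u` to `v`. -/
def IsSingleArc (M : Matrix n n ℂ) (S : Set n) (u v : n) : Prop :=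
  u ∈ S ∧ v ∈ S ∧ u ≠ v ∧ M u v = sixthRoot ∧
    ∀ i ∈ S, ∀ j ∈ S, i ≠ j → ¬ (i = u ∧ j = v) → ¬ (i = v ∧ j = u) → M i j = 1

/-- An edge with nontrivial gain is an arc in one of its directions. A second such edge would either
share a vertex with the first, against `triangle_gains`, or be disjoint from it, against
`not_two_disjoint_arcs`. -/
theorem exists_isSingleArc (hM : IsBridgeMatrix M P a b Q) (h2 : 2 < Fintype.card n)
    (hneg : hM.isHermitian.eigenvalues₀ ⟨2, h2⟩ < 0) {i j s t : n} (hi : i ∈ P) (hj : j ∈ P)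
    (hij : i ≠ j) (h1 : M i j ≠ 1) (hs : s ∈ Q) (ht : t ∈ Q) (hne : s ≠ t) (hst : M s t = 1) :
    ∃ u v, IsSingleArc M P u v := by
  have horient : ∀ x ∈ P, ∀ y ∈ P, x ≠ y → M x y ≠ 1 → M x y = sixthRoot ∨ M y x = sixthRoot := by
    intro x hx y hy hxy h
    rcases hM.gain_left_cases h2 hneg hx hy hxy hs ht hne with hg | hg | hg
    · exact absurd hg h
    · exact Or.inl hg
    · right
      rw [hM.swap x y, hg, map_sub, map_one, conj_sixthRoot, sub_sub_cancel]
  obtain ⟨u, hu, v, hv, huv, hg⟩ : ∃ u ∈ P, ∃ v ∈ P, u ≠ v ∧ M u v = sixthRoot := by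
    rcases horient i hi j hj hij h1 with h | h
    · exact ⟨i, hi, j, hj, hij, h⟩
    · exact ⟨j, hj, i, hi, hij.symm, h⟩
  have hguv : M u v ≠ 1 := by rw [hg]; exact sixthRoot_ne_one
  have hsymm : ∀ x y, M x y = 1 → M y x = 1 := fun x y h => by rw [hM.swap x y, h, map_one]
  have hadj : ∀ x ∈ P, x ≠ u → x ≠ v → M u x = 1 ∧ M v x = 1 := fun x hx hxu hxv =>
    hM.triangle_gains h2 hneg hu hv hx huv hxu.symm hxv.symm hs ht hne hst hguv
  refine ⟨u, v, hu, hv, huv, hg, fun x hx y hy hxy hn1 hn2 => ?_⟩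
  by_cases hxu : x = u
  · subst hxu
    exact (hadj y hy hxy.symm fun h => hn1 ⟨rfl, h⟩).1
  by_cases hxv : x = v
  · subst hxv
    exact (hadj y hy (fun h => hn2 ⟨rfl, h⟩) hxy.symm).2
  by_cases hyu : y = u
  · subst hyu
    exact hsymm _ _ (hadj x hx hxu hxv).1
  by_cases hyv : y = v
  · subst hyv
    exact hsymm _ _ (hadj x hx hxu hxv).2
  by_contra h
  obtain ⟨hux, hvx⟩ := hadj x hx hxu hxv
  obtain ⟨huy, hvy⟩ := hadj y hy hyu hyv
  rcases horient x hx y hy hxy h with h | h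
  · exact hM.not_two_disjoint_arcs h2 hneg hu hv hx hy huv (Ne.symm hxu) (Ne.symm hyu) hs ht hst
      hg h hux huy hvx hvy
  · exact hM.not_two_disjoint_arcs h2 hneg hu hv hy hx huv (Ne.symm hyu) (Ne.symm hxu) hs ht hst
      hg h huy hux hvy hvx

/-- Two nontrivial gains would both have real part `1 / 2`, and the bound with weights `1, 1` would
read `1 < 1`. -/
theorem gain_eq_one_of_other (hM : IsBridgeMatrix M P a b Q) (h2 : 2 < Fintype.card n)
    (hneg : hM.isHermitian.eigenvalues₀ ⟨2, h2⟩ < 0) {i j : n} (hi : i ∈ P) (hj : j ∈ P)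
    (hij : i ≠ j) (h1 : M i j ≠ 1) {s t : n} (hs : s ∈ Q) (ht : t ∈ Q) (hne : s ≠ t) :
    M s t = 1 := by
  by_contra hst
  have hb := hM.gain_re_bound h2 hneg hi hj hij hs ht hne 1 1 one_ne_zero
  have h3 : (M i j).re = 1 / 2 := by
    rcases hM.gain_left_cases h2 hneg hi hj hij hs ht hne with h | h | h
    · exact absurd h h1
    · rw [h, sixthRoot_re]
    · rw [h, Complex.sub_re, sixthRoot_re, Complex.one_re]
      norm_num
  have h4 : (M s t).re = 1 / 2 := by
    rcases hM.symm.gain_left_cases h2 hneg hs ht hne hi hj hij with h | h | h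
    · exact absurd h hst
    · rw [h, sixthRoot_re]
    · rw [h, Complex.sub_re, sixthRoot_re, Complex.one_re]
      norm_num
  rw [h3, h4] at hb
  norm_num at hb

theorem classification (hM : IsBridgeMatrix M P a b Q) (h2 : 2 < Fintype.card n)
    (hneg : hM.isHermitian.eigenvalues₀ ⟨2, h2⟩ < 0) (hP : P.Nontrivial) (hQ : Q.Nontrivial) :
    ((∀ i ∈ P, ∀ j ∈ P, i ≠ j → M i j = 1) ∧ (∀ s ∈ Q, ∀ t ∈ Q, s ≠ t → M s t = 1)) ∨
    ((∃ u v, IsSingleArc M P u v) ∧ (∀ s ∈ Q, ∀ t ∈ Q, s ≠ t → M s t = 1)) ∨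
    ((∀ i ∈ P, ∀ j ∈ P, i ≠ j → M i j = 1) ∧ ∃ s t, IsSingleArc M Q s t) := by
  by_cases hPall : ∀ i ∈ P, ∀ j ∈ P, i ≠ j → M i j = 1
  · by_cases hQall : ∀ s ∈ Q, ∀ t ∈ Q, s ≠ t → M s t = 1
    · exact Or.inl ⟨hPall, hQall⟩
    · push Not at hQall
      obtain ⟨s, hs, t, ht, hst, h⟩ := hQall
      obtain ⟨i, hi, j, hj, hij⟩ := hP
      exact Or.inr (Or.inr ⟨hPall, hM.symm.exists_isSingleArc h2 hneg hs ht hst h hi hj hij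
        (hPall i hi j hj hij)⟩)
  · push Not at hPall
    obtain ⟨i, hi, j, hj, hij, h⟩ := hPall
    have hQall : ∀ s ∈ Q, ∀ t ∈ Q, s ≠ t → M s t = 1 := fun s hs t ht hst =>
      hM.gain_eq_one_of_other h2 hneg hi hj hij h hs ht hst
    obtain ⟨s, hs, t, ht, hst⟩ := hQ
    exact Or.inr (Or.inl ⟨hM.exists_isSingleArc h2 hneg hi hj hij h hs ht hst
      (hQall s hs t ht hst), hQall⟩)

end IsBridgeMatrix

/-! ### Switchings and explicit matrix entries -/

theorem mul_mem_gainSet {z w : ℂ} (hz : z ∈ gainSet) (hw : w ∈ gainSet) : z * w ∈ gainSet := by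
  obtain ⟨k, rfl⟩ := hz
  obtain ⟨l, rfl⟩ := hw
  exact ⟨k + l, (pow_add _ _ _).symm⟩

theorem inv_mem_gainSet {z : ℂ} (hz : z ∈ gainSet) : z⁻¹ ∈ gainSet := by
  obtain ⟨k, rfl⟩ := hz
  refine ⟨5 * k, inv_eq_of_mul_eq_one_right ?_⟩
  rw [← pow_add, show k + 5 * k = 6 * k by ring, pow_mul, sixthRoot_pow_six, one_pow]

namespace SignedDigraph

variable {V : Type*}

theorem eisensteinMatrix_mem_gainSet (Φ : SignedDigraph V) {u v : V} (h : Φ.graph.Adj u v) :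
    Φ.eisensteinMatrix u v ∈ gainSet := by
  rw [eisensteinMatrix_adj Φ h]
  exact Φ.gain_mem _

/-- The gain switching of a signed digraph by a family of sixth roots of unity. -/
noncomputable def switch (Φ : SignedDigraph V) (x : V → ℂ) (hx : ∀ v, x v ∈ gainSet) :
    SignedDigraph V where
  graph := Φ.graph
  gain d := x d.fst * Φ.gain d * (x d.snd)⁻¹
  gain_mem d := mul_mem_gainSet (mul_mem_gainSet (hx _) (Φ.gain_mem d)) (inv_mem_gainSet (hx _))
  gain_symm d := by
    rw [Φ.gain_symm, mul_inv, mul_inv, inv_inv]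
    change x d.snd * (Φ.gain d)⁻¹ * (x d.fst)⁻¹ = _
    ring

theorem eisensteinMatrix_switch (Φ : SignedDigraph V) (x : V → ℂ) (hx : ∀ v, x v ∈ gainSet)
    (u v : V) : (Φ.switch x hx).eisensteinMatrix u v = x u * Φ.eisensteinMatrix u v * (x v)⁻¹ := by
  by_cases h : Φ.graph.Adj u v
  · rw [eisensteinMatrix_adj Φ h, eisensteinMatrix_adj (Φ.switch x hx) h]
    rfl
  · rw [eisensteinMatrix_not_adj Φ h, eisensteinMatrix_not_adj (Φ.switch x hx) h]
    simp

theorem isGainSwitching_switch [Fintype V] [DecidableEq V] (Φ : SignedDigraph V) (x : V → ℂ)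
    (hx : ∀ v, x v ∈ gainSet) : IsGainSwitching Φ (Φ.switch x hx) := by
  refine ⟨x, hx, ?_⟩
  have hinv : (diagonal x)⁻¹ = diagonal fun v => (x v)⁻¹ := by
    refine inv_eq_right_inv ?_
    rw [diagonal_mul_diagonal, ← diagonal_one]
    congr 1
    ext v
    exact mul_inv_cancel₀ (ne_zero_of_mem_gainSet (hx v))
  ext u v
  rw [eisensteinMatrix_switch, hinv, mul_diagonal, diagonal_mul]

open Classical in
theorem eisensteinMatrix_ofGraph (G : SimpleGraph V) (i j : V) :
    (ofGraph G).eisensteinMatrix i j = if G.Adj i j then 1 else 0 := by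
  by_cases h : G.Adj i j
  · rw [eisensteinMatrix_adj (ofGraph G) h, if_pos h]
    rfl
  · rw [eisensteinMatrix_not_adj (ofGraph G) h, if_neg h]

open Classical in
theorem eisensteinMatrix_oneArc (G : SimpleGraph V) (u v i j : V) :
    (oneArc G u v).eisensteinMatrix i j =
      if G.Adj i j then
        if i = u ∧ j = v then sixthRoot else if i = v ∧ j = u then sixthRoot⁻¹ else 1
      else 0 := by
  by_cases h : G.Adj i j
  · rw [eisensteinMatrix_adj (oneArc G u v) h, if_pos h]
    rfl
  · rw [eisensteinMatrix_not_adj (oneArc G u v) h, if_neg h]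

end SignedDigraph

/-! ### The vertices and symmetries of the bridge graph -/

section BridgeVertex

variable {p q : ℕ}

/-- The end of the bridge next to the first clique. -/
def bridgeFst (p q : ℕ) : BridgeVertex p q := ⟨1, (0 : Fin 1)⟩

/-- The end of the bridge next to the last clique. -/
def bridgeSnd (p q : ℕ) : BridgeVertex p q := ⟨2, (0 : Fin 1)⟩

theorem eq_bridgeFst {i : BridgeVertex p q} (h : i.1 = 1) : i = bridgeFst p q := by
  obtain ⟨c, k⟩ := i
  obtain rfl : c = 1 := h
  exact congrArg (Sigma.mk 1) (Subsingleton.elim (α := Fin 1) k 0)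

theorem eq_bridgeSnd {i : BridgeVertex p q} (h : i.1 = 2) : i = bridgeSnd p q := by
  obtain ⟨c, k⟩ := i
  obtain rfl : c = 2 := h
  exact congrArg (Sigma.mk 2) (Subsingleton.elim (α := Fin 1) k 0)

theorem part_cases (i : BridgeVertex p q) : i.1 = 0 ∨ i.1 = 1 ∨ i.1 = 2 ∨ i.1 = 3 := by
  have : ∀ c : Fin 4, c = 0 ∨ c = 1 ∨ c = 2 ∨ c = 3 := by decide
  exact this i.1

theorem bridgeGraph_adj {i j : BridgeVertex p q} : (bridgeGraph p q).Adj i j ↔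
    (i.1.val + 1 = j.1.val ∨ j.1.val + 1 = i.1.val) ∨ i.1 = j.1 ∧ i ≠ j := by
  change (SimpleGraph.pathGraph 4).Adj i.1 j.1 ∨ _ ↔ _
  rw [SimpleGraph.pathGraph_adj]

/-- Two transpositions inside the clique suffice. Overlaps are allowed, in particular `u' = v` and
`v' = u`, so reversing an arc is also a relabeling. -/
theorem exists_perm_of_part_eq {u v u' v' : BridgeVertex p q} (huv : u ≠ v) (huv' : u' ≠ v')
    (h1 : v.1 = u.1) (h2 : u'.1 = u.1) (h3 : v'.1 = u.1) :
    ∃ σ : Equiv.Perm (BridgeVertex p q), σ u = u' ∧ σ v = v' ∧ ∀ i, (σ i).1 = i.1 := by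
  have hswap : ∀ x y i : BridgeVertex p q, x.1 = y.1 → (Equiv.swap x y i).1 = i.1 := by
    intro x y i hxy
    rw [Equiv.swap_apply_def]
    split_ifs with hx hy
    · rw [hx, hxy]
    · rw [hy, hxy]
    · rfl
  have hv : (Equiv.swap u u' v).1 = v.1 := hswap _ _ _ h2.symm
  have hne : u' ≠ Equiv.swap u u' v := by
    rw [← Equiv.swap_apply_left u u']
    exact fun h => huv ((Equiv.swap u u').injective (by simpa using h))
  refine ⟨(Equiv.swap u u').trans (Equiv.swap (Equiv.swap u u' v) v'), ?_, ?_, fun i => ?_⟩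
  · rw [Equiv.trans_apply, Equiv.swap_apply_left, Equiv.swap_apply_of_ne_of_ne hne huv']
  · rw [Equiv.trans_apply, Equiv.swap_apply_left]
  · rw [Equiv.trans_apply, hswap _ _ _ (by rw [hv, h1, h3]), hswap _ _ _ h2.symm]

/-- The bridge graph is a sum of two cliques minus a correction of rank one and a diagonal. -/
theorem bridge_decomposition (i j : BridgeVertex p q) :
    (SignedDigraph.ofGraph (bridgeGraph p q)).eisensteinMatrix i j =
      (if i.1 = 0 ∨ i.1 = 1 then 1 else 0) * (if j.1 = 0 ∨ j.1 = 1 then 1 else 0)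
      + (if i.1 = 2 ∨ i.1 = 3 then 1 else 0) * (if j.1 = 2 ∨ j.1 = 3 then 1 else 0)
      - (if i.1 = 1 then 1 else if i.1 = 2 then -1 else 0)
        * (if j.1 = 1 then 1 else if j.1 = 2 then -1 else 0)
      - if i = j ∧ (i.1 = 0 ∨ i.1 = 3) then 1 else 0 := by
  rw [SignedDigraph.eisensteinMatrix_ofGraph]
  simp only [bridgeGraph_adj]
  by_cases hij : i = j
  · subst hij
    rcases part_cases i with h | h | h | h <;> simp [h]
  · have h1 : i.1 = 1 → j.1 ≠ 1 := fun h h' => hij ((eq_bridgeFst h).trans (eq_bridgeFst h').symm)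
    have h2 : i.1 = 2 → j.1 ≠ 2 := fun h h' => hij ((eq_bridgeSnd h).trans (eq_bridgeSnd h').symm)
    rcases part_cases i with h | h | h | h <;> rcases part_cases j with h' | h' | h' | h' <;>
      first
        | exact absurd h' (h1 h)
        | exact absurd h' (h2 h)
        | simp [h, h', hij]

end BridgeVertex

/-! ### Signs of `λ₂` and `λ₃` for the given signed digraphs -/

namespace SignedDigraph

variable {p q : ℕ}

theorem eigenvalue_two_ofGraph_neg (h2 : 2 < Fintype.card (BridgeVertex p q)) :
    (ofGraph (bridgeGraph p q)).eigenvalue ⟨2, h2⟩ < 0 := by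
  refine eigenvalues₀_neg_of_decomposition
    (ofGraph (bridgeGraph p q)).isHermitian_eisensteinMatrix h2
    (fun i => if i.1 = 0 ∨ i.1 = 1 then 1 else 0) (fun i => if i.1 = 2 ∨ i.1 = 3 then 1 else 0)
    (fun i => if i.1 = 1 then 1 else if i.1 = 2 then -1 else 0) 0
    (fun i => if i.1 = 0 ∨ i.1 = 3 then 1 else 0) (fun i => by positivity) ?_ ?_
  · ext i j
    rw [bridge_decomposition]
    by_cases hij : i = j
    · subst hij
      rcases part_cases i with h | h | h | h <;> simp [h, vecMulVec_apply]
    · rcases part_cases i with h | h | h | h <;> rcases part_cases j with h' | h' | h' | h' <;>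
        simp [h, h', hij, vecMulVec_apply]
  -- The diagonal term forces `x` to vanish on both cliques; then `l` and `m` read off its values at
  -- the two ends of the bridge.
  · intro x hl hm _ _ ht
    have hP : ∀ i : BridgeVertex p q, i.1 = 0 → x i = 0 := fun i hi => ht i (by simp [hi])
    have hQ : ∀ i : BridgeVertex p q, i.1 = 3 → x i = 0 := fun i hi => ht i (by simp [hi])
    rw [dotProduct, Finset.sum_eq_single (bridgeFst p q)
      (fun i _ hne => by
        rcases part_cases i with h | h | h | h
        · simp [hP i h]
        · exact absurd (eq_bridgeFst h) hne
        · simp [h]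
        · simp [h]) (by simp)] at hl
    rw [dotProduct, Finset.sum_eq_single (bridgeSnd p q)
      (fun i _ hne => by
        rcases part_cases i with h | h | h | h
        · simp [h]
        · simp [h]
        · exact absurd (eq_bridgeSnd h) hne
        · simp [hQ i h]) (by simp)] at hm
    ext i
    rcases part_cases i with h | h | h | h
    · exact hP i h
    · rw [eq_bridgeFst h]
      simpa [bridgeFst] using hl
    · rw [eq_bridgeSnd h]
      simpa [bridgeSnd] using hm
    · exact hQ i h

theorem eisensteinMatrix_oneArc_eq {u v : BridgeVertex p q} (huv : u ≠ v) (h : u.1 = v.1)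
    (i j : BridgeVertex p q) :
    (oneArc (bridgeGraph p q) u v).eisensteinMatrix i j =
      (ofGraph (bridgeGraph p q)).eisensteinMatrix i j +
        if i = u ∧ j = v then sixthRoot - 1 else if i = v ∧ j = u then -sixthRoot else 0 := by
  have ha : (bridgeGraph p q).Adj u v := bridgeGraph_adj.mpr (Or.inr ⟨h, huv⟩)
  rw [eisensteinMatrix_oneArc, eisensteinMatrix_ofGraph, sixthRoot_inv]
  by_cases h1 : i = u ∧ j = v
  · rw [if_pos h1, if_pos h1, h1.1, h1.2, if_pos ha, if_pos ha]
    ring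
  · rw [if_neg h1, if_neg h1]
    by_cases h2 : i = v ∧ j = u
    · rw [if_pos h2, if_pos h2, h2.1, h2.2, if_pos ha.symm, if_pos ha.symm]
      ring
    · rw [if_neg h2, if_neg h2, add_zero]

/-- In the decomposition for the graph, the diagonal term at `u, v` is replaced by `r r*` with `r =
e_u + ω e_v`. This keeps the diagonal and adds `-conj ω = ω - 1` to the entry at `(u, v)`, changing
it from `1` to `ω`. -/
theorem eigenvalue_two_oneArc_neg (h2 : 2 < Fintype.card (BridgeVertex p q))
    {u v : BridgeVertex p q} (huv : u ≠ v) (hpart : u.1 = v.1) (hu : u.1 = 0 ∨ u.1 = 3) :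
    (oneArc (bridgeGraph p q) u v).eigenvalue ⟨2, h2⟩ < 0 := by
  have hv : v.1 = 0 ∨ v.1 = 3 := hpart ▸ hu
  have hsq := sixthRoot_sq
  refine eigenvalues₀_neg_of_decomposition
    (oneArc (bridgeGraph p q) u v).isHermitian_eisensteinMatrix h2
    (fun i => if i.1 = 0 ∨ i.1 = 1 then 1 else 0) (fun i => if i.1 = 2 ∨ i.1 = 3 then 1 else 0)
    (fun i => if i.1 = 1 then 1 else if i.1 = 2 then -1 else 0)
    (fun i => if i = u then 1 else if i = v then sixthRoot else 0)
    (fun i => if (i.1 = 0 ∨ i.1 = 3) ∧ i ≠ u ∧ i ≠ v then 1 else 0) (fun i => by positivity) ?_ ?_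
  · ext i j
    rw [eisensteinMatrix_oneArc_eq huv hpart, bridge_decomposition]
    have key : (if i = u ∧ j = v then sixthRoot - 1 else if i = v ∧ j = u then -sixthRoot else 0)
        - (if i = j ∧ (i.1 = 0 ∨ i.1 = 3) then 1 else 0)
        = -((if i = u then 1 else if i = v then sixthRoot else 0)
          * conj (if j = u then 1 else if j = v then sixthRoot else 0))
          - if i = j then (((if (i.1 = 0 ∨ i.1 = 3) ∧ i ≠ u ∧ i ≠ v then 1 else 0 : ℝ)) : ℂ)
            else 0 := by
      have hvu := huv.symm
      by_cases hiu : i = u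
      · subst hiu
        by_cases hji : j = i
        · subst hji
          simp [huv, hu]
        · by_cases hjv : j = v
          · subst hjv
            simp [huv, hvu, conj_sixthRoot]
          · simp [huv, hji, hjv, Ne.symm hji]
      · by_cases hiv : i = v
        · subst hiv
          by_cases hji : j = i
          · subst hji
            simp [hiu, hv, conj_sixthRoot]
            linear_combination hsq
          · by_cases hju : j = u
            · subst hju
              simp [hiu, huv]
            · simp [hiu, hji, hju, Ne.symm hji]
        · by_cases hij : i = j
          · subst hij
            simp [hiu, hiv]
            split_ifs <;> simp
          · simp [hiu, hiv, hij]
    simp only [vecMulVec_apply, Matrix.sub_apply, Matrix.add_apply, diagonal_apply, Pi.star_apply,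
      Complex.star_def, apply_ite conj, map_one, map_zero, map_neg] at key ⊢
    linear_combination key
  · intro x hl hm hd hr ht
    have hz : ∀ i : BridgeVertex p q, (i.1 = 0 ∨ i.1 = 3) → i ≠ u → i ≠ v → x i = 0 :=
      fun i hi hiu hiv => ht i (by simp [hi, hiu, hiv])
    have hfs : bridgeFst p q ≠ bridgeSnd p q := fun h => by
      simpa [bridgeFst, bridgeSnd] using congrArg Sigma.fst h
    rw [dotProduct, Fintype.sum_eq_add _ _ huv fun i hi => by simp [hi.1, hi.2]] at hr
    rw [dotProduct, Fintype.sum_eq_add _ _ hfs fun i hi => by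
      have h1 : i.1 ≠ 1 := fun h => hi.1 (eq_bridgeFst h)
      have h2 : i.1 ≠ 2 := fun h => hi.2 (eq_bridgeSnd h)
      simp [h1, h2]] at hd
    simp only [Pi.star_apply, if_pos, if_neg huv.symm, star_one, one_mul, Complex.star_def,
      conj_sixthRoot] at hr
    have hd' : x (bridgeFst p q) = x (bridgeSnd p q) := by
      simp [bridgeFst, bridgeSnd] at hd
      exact add_neg_eq_zero.mp hd
    -- The `r`-condition is `x u + (1 - ω) x v = 0`; together with `x u + x v = 0` it gives `ω x v =
    -- 0`.
    have hconcl : x u + x v = 0 → x (bridgeFst p q) = 0 → x = 0 := by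
      intro hsum hF
      have hxv : x v = 0 := by
        have : sixthRoot * x v = 0 := by linear_combination hsum - hr
        exact (mul_eq_zero.mp this).resolve_left sixthRoot_ne_zero
      have hxu : x u = 0 := by simpa [hxv] using hsum
      ext i
      by_cases hiu : i = u
      · rw [hiu]; exact hxu
      by_cases hiv : i = v
      · rw [hiv]; exact hxv
      rcases part_cases i with h | h | h | h
      · exact hz i (Or.inl h) hiu hiv
      · rw [eq_bridgeFst h]; exact hF
      · rw [eq_bridgeSnd h, ← hd']; exact hF
      · exact hz i (Or.inr h) hiu hiv
    -- The positive vector of the clique without the arc gives `x = 0` at its end of the bridge, `d`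
    -- carries this to the other end, and the other positive vector then gives `x u + x v = 0`.
    rcases hu with hu | hu
    · have hv : v.1 = 0 := hpart ▸ hu
      rw [dotProduct, Fintype.sum_eq_single (bridgeSnd p q) fun i hne => by
        rcases part_cases i with h | h | h | h
        · simp [h]
        · simp [h]
        · exact absurd (eq_bridgeSnd h) hne
        · rw [hz i (Or.inr h) (fun e => by simp [e, hu] at h) (fun e => by simp [e, hv] at h),
            mul_zero]] at hm
      have hF : x (bridgeFst p q) = 0 := by
        rw [hd']
        simpa [bridgeSnd] using hm
      refine hconcl ?_ hF
      rw [dotProduct, Fintype.sum_eq_add _ _ huv fun i hi => by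
        rcases part_cases i with h | h | h | h
        · rw [hz i (Or.inl h) hi.1 hi.2, mul_zero]
        · rw [eq_bridgeFst h, hF, mul_zero]
        · simp [h]
        · simp [h]] at hl
      simpa [hu, hv] using hl
    · have hv : v.1 = 3 := hpart ▸ hu
      rw [dotProduct, Fintype.sum_eq_single (bridgeFst p q) fun i hne => by
        rcases part_cases i with h | h | h | h
        · rw [hz i (Or.inl h) (fun e => by simp [e, hu] at h) (fun e => by simp [e, hv] at h),
            mul_zero]
        · exact absurd (eq_bridgeFst h) hne
        · simp [h]
        · simp [h]] at hl
      have hF : x (bridgeFst p q) = 0 := by simpa [bridgeFst] using hl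
      refine hconcl ?_ hF
      rw [dotProduct, Fintype.sum_eq_add _ _ huv fun i hi => by
        rcases part_cases i with h | h | h | h
        · simp [h]
        · simp [h]
        · rw [eq_bridgeSnd h, ← hd', hF, mul_zero]
        · rw [hz i (Or.inr h) hi.1 hi.2, mul_zero]] at hm
      simpa [hu, hv] using hm

/-- An edge of `P` with gain `g` carries `(1, conj g)`, of form `2`. The same holds for an edge of
`Q`, and no edges join `P` to `Q`. -/
theorem eigenvalue_one_pos (Φ : SignedDigraph (BridgeVertex p q)) (hΦ : Φ.graph = bridgeGraph p q)
    (h1 : 1 < Fintype.card (BridgeVertex p q))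
    {u v s t : BridgeVertex p q} (hu : u.1 = 0) (hv : v.1 = 0) (huv : u ≠ v)
    (hs : s.1 = 3) (ht : t.1 = 3) (hst : s ≠ t) : 0 < Φ.eigenvalue ⟨1, h1⟩ := by
  have huv' : Φ.graph.Adj u v := by
    rw [hΦ, bridgeGraph_adj]
    exact Or.inr ⟨hu.trans hv.symm, huv⟩
  have hst' : Φ.graph.Adj s t := by
    rw [hΦ, bridgeGraph_adj]
    exact Or.inr ⟨hs.trans ht.symm, hst⟩
  have hn : ∀ i j : BridgeVertex p q, i.1 = 0 → j.1 = 3 → Φ.eisensteinMatrix i j = 0 ∧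
      Φ.eisensteinMatrix j i = 0 := by
    intro i j hi hj
    have h : ¬ Φ.graph.Adj i j := by
      rw [hΦ, bridgeGraph_adj]
      simp [hi, hj]
    exact ⟨eisensteinMatrix_not_adj Φ h, eisensteinMatrix_not_adj Φ fun h' => h h'.symm⟩
  have hg := mul_conj_of_mem_gainSet (eisensteinMatrix_mem_gainSet Φ huv')
  have hk := mul_conj_of_mem_gainSet (eisensteinMatrix_mem_gainSet Φ hst')
  have hA := Φ.isHermitian_eisensteinMatrix
  have hd : ∀ i, Φ.eisensteinMatrix i i = 0 := fun i =>
    eisensteinMatrix_not_adj Φ (Φ.graph.loopless.irrefl i)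
  have hvu : Φ.eisensteinMatrix v u = conj (Φ.eisensteinMatrix u v) := (hA.apply v u).symm
  have hts : Φ.eisensteinMatrix t s = conj (Φ.eisensteinMatrix s t) := (hA.apply t s).symm
  set g := Φ.eisensteinMatrix u v with hgdef
  set k := Φ.eisensteinMatrix s t with hkdef
  have hB : Φ.eisensteinMatrix.submatrix ![u, v, s, t] ![u, v, s, t]
      = !![0, g, 0, 0; conj g, 0, 0, 0; 0, 0, 0, k; 0, 0, conj k, 0] := by
    ext x y
    fin_cases x <;> fin_cases y <;> simp [hd, hvu, hts, ← hgdef, ← hkdef, hn, hu, hv, hs, ht]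
  refine eigenvalues₀_pos_of_sesqForm_pos hA h1
    (f := (1 : Matrix _ _ ℂ).submatrix id ![u, v, s, t] *ᵥ ![1, conj g, 0, 0])
    (g := (1 : Matrix _ _ ℂ).submatrix id ![u, v, s, t] *ᵥ ![0, 0, 1, conj k]) ?_ ?_ ?_
  · rw [← sesqForm_submatrix, hB]
    simp [sesqForm, mulVec, dotProduct, Fin.sum_univ_succ]
  · rw [← sesqForm_submatrix, hB]
    simp [sesqForm, mulVec, dotProduct, Fin.sum_univ_succ, -Complex.mul_re] at hg ⊢
    simp only [hg]
    norm_num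
  · rw [← sesqForm_submatrix, hB]
    simp [sesqForm, mulVec, dotProduct, Fin.sum_univ_succ, -Complex.mul_re] at hk ⊢
    simp only [hk]
    norm_num

end SignedDigraph

/-! ### Normalization by switching and the conclusion -/

section Normalization

variable {p q : ℕ}

open SignedDigraph

theorem exists_normalized_switching (Φ : SignedDigraph (BridgeVertex p q))
    (hΦ : Φ.graph = bridgeGraph p q) :
    ∃ Ψ : SignedDigraph (BridgeVertex p q), IsGainSwitching Φ Ψ ∧ Ψ.graph = bridgeGraph p q ∧
      IsBridgeMatrix Ψ.eisensteinMatrix {i | i.1 = 0} (bridgeFst p q) (bridgeSnd p q)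
        {i | i.1 = 3} := by
  have hadj : ∀ {i j : BridgeVertex p q}, i.1.val + 1 = j.1.val ∨ j.1.val + 1 = i.1.val →
      Φ.eisensteinMatrix i j ∈ gainSet := fun h =>
    eisensteinMatrix_mem_gainSet Φ (by rw [hΦ, bridgeGraph_adj]; exact Or.inl h)
  have hPF : ∀ i : BridgeVertex p q, i.1 = 0 → Φ.eisensteinMatrix i (bridgeFst p q) ∈ gainSet :=
    fun i hi => hadj (by simp [hi, bridgeFst])
  have hFS : Φ.eisensteinMatrix (bridgeFst p q) (bridgeSnd p q) ∈ gainSet :=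
    hadj (by simp [bridgeFst, bridgeSnd])
  have hQS : ∀ i : BridgeVertex p q, i.1 = 3 → Φ.eisensteinMatrix i (bridgeSnd p q) ∈ gainSet :=
    fun i hi => hadj (by simp [hi, bridgeSnd])
  -- Starting with `1` at the root `bridgeFst`, each value is the one that turns the gain of the
  -- tree edge towards the root into `1`.
  let x : BridgeVertex p q → ℂ := fun i =>
    if i.1 = 0 then (Φ.eisensteinMatrix i (bridgeFst p q))⁻¹
    else if i.1 = 1 then 1
    else if i.1 = 2 then Φ.eisensteinMatrix (bridgeFst p q) (bridgeSnd p q)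
    else Φ.eisensteinMatrix (bridgeFst p q) (bridgeSnd p q)
      * (Φ.eisensteinMatrix i (bridgeSnd p q))⁻¹
  have hx : ∀ i, x i ∈ gainSet := by
    intro i
    rcases part_cases i with h | h | h | h
    · simpa [x, h] using inv_mem_gainSet (hPF i h)
    · simpa [x, h] using one_mem_gainSet
    · simpa [x, h] using hFS
    · simpa [x, h] using mul_mem_gainSet hFS (inv_mem_gainSet (hQS i h))
  have hg : (Φ.switch x hx).graph = bridgeGraph p q := hΦ
  have hnot : ∀ i j : BridgeVertex p q, ¬ (bridgeGraph p q).Adj i j →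
      (Φ.switch x hx).eisensteinMatrix i j = 0 := fun i j h =>
    eisensteinMatrix_not_adj _ (by rw [hg]; exact h)
  have hin : ∀ i j : BridgeVertex p q, (bridgeGraph p q).Adj i j →
      (Φ.switch x hx).eisensteinMatrix i j ∈ gainSet := fun i j h =>
    eisensteinMatrix_mem_gainSet _ (by rw [hg]; exact h)
  refine ⟨Φ.switch x hx, isGainSwitching_switch Φ x hx, hg, ?_⟩
  constructor
  · exact isHermitian_eisensteinMatrix _
  · exact fun i => hnot i i ((bridgeGraph p q).loopless.irrefl i)
  · exact fun i hi j hj hij => hin i j (bridgeGraph_adj.mpr (Or.inr ⟨hi.trans hj.symm, hij⟩))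
  · exact fun i hi j hj hij => hin i j (bridgeGraph_adj.mpr (Or.inr ⟨hi.trans hj.symm, hij⟩))
  · intro i hi
    have hi : i.1 = 0 := hi
    have hF : x (bridgeFst p q) = 1 := by simp [x, bridgeFst]
    have hxi : x i = (Φ.eisensteinMatrix i (bridgeFst p q))⁻¹ := by simp [x, hi]
    rw [eisensteinMatrix_switch, hF, hxi, inv_mul_cancel₀ (ne_zero_of_mem_gainSet (hPF i hi))]
    simp
  · have hF : x (bridgeFst p q) = 1 := by simp [x, bridgeFst]
    have hS : x (bridgeSnd p q) = Φ.eisensteinMatrix (bridgeFst p q) (bridgeSnd p q) := by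
      simp [x, show (bridgeSnd p q).1 = 2 from rfl]
    rw [eisensteinMatrix_switch, hF, hS, one_mul, mul_inv_cancel₀ (ne_zero_of_mem_gainSet hFS)]
  · intro i hi
    have hi : i.1 = 3 := hi
    have hS : x (bridgeSnd p q) = Φ.eisensteinMatrix (bridgeFst p q) (bridgeSnd p q) := by
      simp [x, show (bridgeSnd p q).1 = 2 from rfl]
    have hxi : x i = Φ.eisensteinMatrix (bridgeFst p q) (bridgeSnd p q)
        * (Φ.eisensteinMatrix i (bridgeSnd p q))⁻¹ := by simp [x, hi]
    rw [eisensteinMatrix_switch, hS, hxi,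
      inv_mul_cancel_right₀ (ne_zero_of_mem_gainSet (hQS i hi)),
      mul_inv_cancel₀ (ne_zero_of_mem_gainSet hFS)]
  · intro i hi j hj
    have hi : i.1 = 0 := hi
    have hj : j.1 = 3 := hj
    exact hnot i j (by simp [bridgeGraph_adj, hi, hj])
  · intro i hi
    have hi : i.1 = 0 := hi
    exact hnot i _ (by simp [bridgeGraph_adj, hi, show (bridgeSnd p q).1 = 2 from rfl])
  · intro i hi
    have hi : i.1 = 3 := hi
    exact hnot i _ (by simp [bridgeGraph_adj, hi, show (bridgeFst p q).1 = 1 from rfl])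

theorem IsBridgeMatrix.eq_one_of_adj {M : Matrix (BridgeVertex p q) (BridgeVertex p q) ℂ}
    (hM : IsBridgeMatrix M {i | i.1 = 0} (bridgeFst p q) (bridgeSnd p q) {i | i.1 = 3})
    {i j : BridgeVertex p q} (h : (bridgeGraph p q).Adj i j) :
    (i.1 = 0 ∧ j.1 = 0) ∨ (i.1 = 3 ∧ j.1 = 3) ∨ M i j = 1 := by
  have hsymm : ∀ {x y}, M x y = 1 → M y x = 1 := fun {x y} h => by rw [hM.swap x y, h, map_one]
  have hne := h.ne
  rw [bridgeGraph_adj] at h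
  rcases part_cases i with hi | hi | hi | hi <;> rcases part_cases j with hj | hj | hj | hj
  all_goals try (exfalso; simp [hi, hj] at h; done)
  · exact Or.inl ⟨hi, hj⟩
  · right; right; rw [eq_bridgeFst hj]; exact hM.left_fst i hi
  · right; right; rw [eq_bridgeFst hi]; exact hsymm (hM.left_fst j hj)
  · exact absurd ((eq_bridgeFst hi).trans (eq_bridgeFst hj).symm) hne
  · right; right; rw [eq_bridgeFst hi, eq_bridgeSnd hj]; exact hM.fst_snd
  · right; right; rw [eq_bridgeFst hj, eq_bridgeSnd hi]; exact hsymm hM.fst_snd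
  · exact absurd ((eq_bridgeSnd hi).trans (eq_bridgeSnd hj).symm) hne
  · right; right; rw [eq_bridgeSnd hi]; exact hsymm (hM.right_snd j hj)
  · right; right; rw [eq_bridgeSnd hj]; exact hM.right_snd i hi
  · exact Or.inr (Or.inl ⟨hi, hj⟩)

theorem eisensteinMatrix_eq_oneArc {Ψ : SignedDigraph (BridgeVertex p q)}
    (hΨ : Ψ.graph = bridgeGraph p q) {u v : BridgeVertex p q}
    (huv : Ψ.eisensteinMatrix u v = sixthRoot)
    (h1 : ∀ i j, (bridgeGraph p q).Adj i j → ¬ (i = u ∧ j = v) → ¬ (i = v ∧ j = u) →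
      Ψ.eisensteinMatrix i j = 1) :
    Ψ.eisensteinMatrix = (oneArc (bridgeGraph p q) u v).eisensteinMatrix := by
  ext i j
  rw [eisensteinMatrix_oneArc]
  split_ifs with ha hij hji
  · rw [hij.1, hij.2, huv]
  · rw [hji.1, hji.2, ← Ψ.isHermitian_eisensteinMatrix.apply v u, huv, star_sixthRoot,
      sixthRoot_inv]
  · exact h1 i j ha hij hji
  · exact eisensteinMatrix_not_adj _ (by rw [hΨ]; exact ha)

theorem isRelabeling_oneArc {u v u' v' : BridgeVertex p q} (huv : u ≠ v) (huv' : u' ≠ v')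
    (h1 : v.1 = u.1) (h2 : u'.1 = u.1) (h3 : v'.1 = u.1) :
    IsRelabeling (oneArc (bridgeGraph p q) u' v') (oneArc (bridgeGraph p q) u v) := by
  obtain ⟨σ, hu, hv, hσ⟩ := exists_perm_of_part_eq huv huv' h1 h2 h3
  refine ⟨σ, ?_⟩
  ext i j
  have ha : (bridgeGraph p q).Adj (σ i) (σ j) ↔ (bridgeGraph p q).Adj i j := by
    simp only [bridgeGraph_adj, hσ, ne_eq, σ.injective.eq_iff]
  simp only [submatrix_apply, eisensteinMatrix_oneArc, ← hu, ← hv, σ.injective.eq_iff]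
  by_cases h : (bridgeGraph p q).Adj i j
  · rw [if_pos h, if_pos (ha.mpr h)]
    split_ifs <;> rfl
  · rw [if_neg h, if_neg (fun h' => h (ha.mp h'))]

theorem switchingIsomorphic_oneArc {Φ Ψ : SignedDigraph (BridgeVertex p q)}
    (hsw : IsGainSwitching Φ Ψ) {u v u' v' : BridgeVertex p q} (huv : u ≠ v) (huv' : u' ≠ v')
    (h1 : v.1 = u.1) (h2 : u'.1 = u.1) (h3 : v'.1 = u.1)
    (hΨ : Ψ.eisensteinMatrix = (oneArc (bridgeGraph p q) u' v').eisensteinMatrix) :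
    Φ.SwitchingIsomorphic (oneArc (bridgeGraph p q) u v) := by
  obtain ⟨x, hx, h⟩ := hsw
  have hΦ' : IsGainSwitching Φ (oneArc (bridgeGraph p q) u' v') := ⟨x, hx, hΨ.symm.trans h⟩
  -- No converse is needed, since the relabeling also settles the direction of the arc.
  refine ⟨oneArc (bridgeGraph p q) u v, ?_, Or.inl rfl⟩
  exact Relation.ReflTransGen.tail (Relation.ReflTransGen.single (Or.inl hΦ'))
    (Or.inr (isRelabeling_oneArc huv huv' h1 h2 h3))

theorem switchingIsomorphic_of_eigenvalue_two_neg
    {u v : BridgeVertex p q} (hu : u.1 = 0) (hv : v.1 = 0) (huv : u ≠ v)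
    {s t : BridgeVertex p q} (hs : s.1 = 3) (ht : t.1 = 3) (hst : s ≠ t)
    {Φ : SignedDigraph (BridgeVertex p q)} (hΦ : Φ.graph = bridgeGraph p q)
    (h2 : 2 < Fintype.card (BridgeVertex p q)) (hneg : Φ.eigenvalue ⟨2, h2⟩ < 0) :
    Φ.SwitchingIsomorphic (ofGraph (bridgeGraph p q)) ∨
      Φ.SwitchingIsomorphic (oneArc (bridgeGraph p q) u v) ∨
      Φ.SwitchingIsomorphic (oneArc (bridgeGraph p q) s t) := by
  obtain ⟨Ψ, hsw, hΨ, hM⟩ := exists_normalized_switching Φ hΦ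
  rw [eigenvalue_congr hsw.charpoly_eq] at hneg
  rcases hM.classification h2 hneg ⟨u, hu, v, hv, huv⟩ ⟨s, hs, t, ht, hst⟩ with
    ⟨hP, hQ⟩ | ⟨⟨u', v', hu', hv', huv', hg, hP⟩, hQ⟩ | ⟨hP, s', t', hs', ht', hst', hg, hQ⟩
  · left
    have hE : Ψ.eisensteinMatrix = (ofGraph (bridgeGraph p q)).eisensteinMatrix := by
      ext i j
      rw [eisensteinMatrix_ofGraph]
      split_ifs with ha
      · rcases hM.eq_one_of_adj ha with h | h | h
        · exact hP i h.1 j h.2 ha.ne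
        · exact hQ i h.1 j h.2 ha.ne
        · exact h
      · exact eisensteinMatrix_not_adj _ (by rw [hΨ]; exact ha)
    obtain ⟨x, hx, h⟩ := hsw
    exact ⟨_, Relation.ReflTransGen.single (Or.inl ⟨x, hx, hE.symm.trans h⟩), Or.inl rfl⟩
  · right; left
    refine switchingIsomorphic_oneArc hsw huv huv' (hv.trans hu.symm)
      (Eq.trans hu' hu.symm) (Eq.trans hv' hu.symm)
      (eisensteinMatrix_eq_oneArc hΨ hg fun i j ha hij hji => ?_)
    rcases hM.eq_one_of_adj ha with h | h | h
    · exact hP i h.1 j h.2 ha.ne hij hji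
    · exact hQ i h.1 j h.2 ha.ne
    · exact h
  · right; right
    refine switchingIsomorphic_oneArc hsw hst hst' (ht.trans hs.symm)
      (Eq.trans hs' hs.symm) (Eq.trans ht' hs.symm)
      (eisensteinMatrix_eq_oneArc hΨ hg fun i j ha hij hji => ?_)
    rcases hM.eq_one_of_adj ha with h | h | h
    · exact hP i h.1 j h.2 ha.ne
    · exact hQ i h.1 j h.2 ha.ne hij hji
    · exact h

end Normalization

theorem mainTheorem10 (p q : ℕ) (hp : 2 ≤ p) (hq : 2 ≤ q)
    (u v : BridgeVertex p q) (hu : u.1 = 0) (hv : v.1 = 0) (huv : u ≠ v)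
    (s t : BridgeVertex p q) (hs : s.1 = 3) (ht : t.1 = 3) (hst : s ≠ t)
    (Φ : SignedDigraph (BridgeVertex p q)) (hΦ : Φ.graph = bridgeGraph p q) :
    (0 < Φ.eigenvalue ⟨1, lt_trans one_lt_two (two_lt_card_bridgeVertex hp)⟩ ∧
        Φ.eigenvalue ⟨2, two_lt_card_bridgeVertex hp⟩ < 0) ↔
      (Φ.SwitchingIsomorphic (SignedDigraph.ofGraph (bridgeGraph p q)) ∨
        Φ.SwitchingIsomorphic (SignedDigraph.oneArc (bridgeGraph p q) u v) ∨
        Φ.SwitchingIsomorphic (SignedDigraph.oneArc (bridgeGraph p q) s t)) := by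
  refine ⟨fun h => switchingIsomorphic_of_eigenvalue_two_neg hu hv huv hs ht hst hΦ _ h.2,
    fun h => ⟨Φ.eigenvalue_one_pos hΦ _ hu hv huv hs ht hst, ?_⟩⟩
  rcases h with h | h | h
  · rw [h.eigenvalue_eq]
    exact SignedDigraph.eigenvalue_two_ofGraph_neg _
  · rw [h.eigenvalue_eq]
    exact SignedDigraph.eigenvalue_two_oneArc_neg _ huv (hu.trans hv.symm) (Or.inl hu)
  · rw [h.eigenvalue_eq]
    exact SignedDigraph.eigenvalue_two_oneArc_neg _ hst (hs.trans ht.symm) (Or.inr hs)
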